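/- **Notation.** Let $H=\sum_{a=1}^L H_a$ be a Hamiltonian on $n$ qubits with Hermitian terms $H_a$. It is $k$-local if each $H_a$ acts non-trivially on at most $k$ qubits; it is stoquastic if $\langle x|H_a|y\rangle$ is real and $\le 0$ for all $a$ and all computational basis states $x\ne y$; it is frustration-free if every ground state of $H$ is a ground state of each $H_a$; SFF means stoquastic and frustration-free. $H$ has energy gap at least $\Delta>0$ if every eigenvalue of $H$ other than its smallest eigenvalue $E_0$ is at least $E_0+\Delta$. Let $\Pi$ be the orthogonal projection onto the ground subspace of $H$, $|+\rangle=2^{-n/2}\sum_{x\in\{0,1\}^n}|x\rangle$, $\eta=\sqrt{\langle +|\Pi|+\rangle}$ and $|\psi_0\rangle=\frac1\eta\Pi|+\rangle$. A deep Boltzmann machine (DBM) has $n$ visible nodes and two hidden layers, of $m$ middle and $d$ deep nodes; its edges join only visible to middle and middle to deep nodes. It has a real bias for each node and a real weight for each edge, and for $x\in\{0,1\}^n$, $h\in\{0,1\}^m$, $g\in\{0,1\}^d$ its energy is $$F(x,h,g)=-\sum_i a_ix_i-\sum_j b_jh_j-\sum_l c_lg_l-\sum_{(i,j)}W_{ij}x_ih_j-\sum_{(j,l)}U_{jl}h_jg_l,$$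 the last two sums running over the edges. Its output is $f(x)=\sum_{h,g}e^{-F(x,h,g)}$. It represents a state $|\psi\rangle$ to precision $\epsilon$ if $$\frac12\sum_x\left|\frac{f(x)}{\sum_yf(y)}-|\langle x|\psi\rangle|^2\right|\le\epsilon .$$ **Theorem.** There is an absolute constant $C>0$ such that the following holds. Let $H=\sum_{a=1}^LH_a$ be a $k$-local SFF Hamiltonian on $n$ qubits with energy gap at least $\Delta>0$ and with $\|H_a\|_{\mathrm{op}}\le J$ for all $a$. Then $\eta>0$ and $\log(\eta^{-1})\le\frac n2\log 2$, and for every $0<\epsilon\le 1$ the state $|\psi_0\rangle$ is represented to precision $\epsilon$ by a DBM with at most $$C\,2^{2k}L^3J\Delta^{-1}\log(\eta^{-1}\epsilon^{-1})$$ hidden nodes, where each node (visible or hidden) has at most $2^{2k+1}$ connections. -/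

import Mathlib

noncomputable section

/-- Bit strings of length `n`; they index the computational basis of `n` qubits. -/
abbrev Bits (n : ℕ) : Type := Fin n → Bool

/-- The Hilbert space of `n` qubits. -/
abbrev QState (n : ℕ) : Type := EuclideanSpace ℂ (Bits n)

/-- Operators on `n` qubits, as matrices in the computational basis. -/
abbrev QOp (n : ℕ) : Type := Matrix (Bits n) (Bits n) ℂ

/-- The operator norm of an operator on `n` qubits (induced by the Hilbert space norm). -/
def opNorm {n : ℕ} (A : QOp n) : ℝ := ‖Matrix.toEuclideanCLM (𝕜 := ℂ) A‖

/-- `A = B ⊗ 1`, where `B` acts on the qubits in `S`. -/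
def ActsOn {n : ℕ} (S : Finset (Fin n)) (A : QOp n) : Prop :=
  ∃ B : Matrix (S → Bool) (S → Bool) ℂ, ∀ x y : Bits n,
    ((∀ i, i ∉ S → x i = y i) → A x y = B (fun i => x i) (fun i => y i)) ∧
    ((¬ ∀ i, i ∉ S → x i = y i) → A x y = 0)

/-- `A` acts non-trivially on at most `k` qubits. -/
def IsLocalOp {n : ℕ} (k : ℕ) (A : QOp n) : Prop :=
  ∃ S : Finset (Fin n), S.card ≤ k ∧ ActsOn S A

/-- The real eigenvalues of an operator. (For a Hermitian operator: all its eigenvalues.) -/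
def energies {n : ℕ} (A : QOp n) : Set ℝ :=
  {E : ℝ | Module.End.HasEigenvalue (Matrix.toEuclideanLin A) (E : ℂ)}

/-- The smallest eigenvalue of a Hermitian operator. -/
def groundEnergy {n : ℕ} (A : QOp n) : ℝ := sInf (energies A)

/-- The ground subspace: the eigenspace of the smallest eigenvalue. -/
def groundSpace {n : ℕ} (A : QOp n) : Submodule ℂ (QState n) :=
  Module.End.eigenspace (Matrix.toEuclideanLin A) (groundEnergy A : ℂ)

/-- The Hamiltonian `H = ∑ a, H_a` with the given terms. -/
def totalHam {n L : ℕ} (h : Fin L → QOp n) : QOp n := ∑ a, h a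

/-- The `h a` are the terms of a `k`-local Hamiltonian. -/
def IsLocalHam {n L : ℕ} (k : ℕ) (h : Fin L → QOp n) : Prop :=
  ∀ a, (h a).IsHermitian ∧ IsLocalOp k (h a)

/-- Each term has real non-positive off-diagonal entries. -/
def IsStoquastic {n L : ℕ} (h : Fin L → QOp n) : Prop :=
  ∀ a x y, x ≠ y → (h a x y).im = 0 ∧ (h a x y).re ≤ 0

/-- Every ground state of the total Hamiltonian is a ground state of each term. -/
def IsFrustrationFree {n L : ℕ} (h : Fin L → QOp n) : Prop :=
  ∀ a, groundSpace (totalHam h) ≤ groundSpace (h a)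

/-- `k`-local stoquastic frustration-free (SFF) Hamiltonians. -/
def IsSFF {n L : ℕ} (k : ℕ) (h : Fin L → QOp n) : Prop :=
  IsLocalHam k h ∧ IsStoquastic h ∧ IsFrustrationFree h

/-- `A` has energy gap (at least) `Δ > 0` above its ground energy. -/
def HasEnergyGap {n : ℕ} (A : QOp n) (Δ : ℝ) : Prop :=
  0 < Δ ∧ ∀ E ∈ energies A, E ≠ groundEnergy A → groundEnergy A + Δ ≤ E

/-- The uniform superposition state. -/
def plusState (n : ℕ) : QState n :=
  WithLp.toLp 2 (fun _ => (((Real.sqrt ((2 : ℝ) ^ n))⁻¹ : ℝ) : ℂ))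

/-- `Π |+⟩`, with `Π` the orthogonal projection onto the ground subspace. -/
def projPlus {n : ℕ} (A : QOp n) : QState n :=
  (groundSpace A).starProjection (plusState n)

/-- `η = √⟨+|Π|+⟩`. -/
def groundOverlap {n : ℕ} (A : QOp n) : ℝ :=
  Real.sqrt (inner ℂ (plusState n) (projPlus A)).re

/-- The ground state `|ψ₀⟩ = η⁻¹ Π |+⟩`. -/
def groundState {n : ℕ} (A : QOp n) : QState n :=
  (((groundOverlap A)⁻¹ : ℝ) : ℂ) • projPlus A

/-- The distribution of a state in the computational basis: `x ↦ |⟨x|ψ⟩|²`. -/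
def stateDist {n : ℕ} (ψ : QState n) (x : Bits n) : ℝ := ‖ψ x‖ ^ 2

/-- Total variation distance of two functions on a finite set. -/
def tvDist {α : Type*} [Fintype α] (p q : α → ℝ) : ℝ := (1 / 2) * ∑ x, |p x - q x|

/-- The real value of a bit. -/
def bitVal (b : Bool) : ℝ := if b then 1 else 0

/-- A (three-layer, real) Deep Boltzmann Machine with `n` visible nodes, `m` hidden nodes in the
middle layer and `d` hidden nodes in the deep layer. Edges join consecutive layers only. -/
structure DBM (n m d : ℕ) where
  /-- edges between the visible and the middle layer -/
  edgesVM : Finset (Fin n × Fin m)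
  /-- edges between the middle and the deep layer -/
  edgesMD : Finset (Fin m × Fin d)
  /-- weights of the visible-middle edges -/
  weightVM : Fin n → Fin m → ℝ
  /-- weights of the middle-deep edges -/
  weightMD : Fin m → Fin d → ℝ
  /-- biases of the visible nodes -/
  biasV : Fin n → ℝ
  /-- biases of the middle nodes -/
  biasM : Fin m → ℝ
  /-- biases of the deep nodes -/
  biasD : Fin d → ℝ

namespace DBM

variable {n m d : ℕ}

/-- The energy of a configuration of all nodes. -/
def energy (B : DBM n m d) (x : Bits n) (h : Bits m) (g : Bits d) : ℝ :=
  - (∑ i, B.biasV i * bitVal (x i)) - (∑ j, B.biasM j * bitVal (h j))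
    - (∑ l, B.biasD l * bitVal (g l))
    - (∑ e ∈ B.edgesVM, B.weightVM e.1 e.2 * bitVal (x e.1) * bitVal (h e.2))
    - (∑ e ∈ B.edgesMD, B.weightMD e.1 e.2 * bitVal (h e.1) * bitVal (g e.2))

/-- The output: the sum of `exp (-F)` over all values of the hidden nodes. -/
def output (B : DBM n m d) (x : Bits n) : ℝ :=
  ∑ h : Bits m, ∑ g : Bits d, Real.exp (-B.energy x h g)

/-- The normalised output. -/
def dist (B : DBM n m d) (x : Bits n) : ℝ := B.output x / ∑ y, B.output y

/-- Number of connections of a visible node. -/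
def degV (B : DBM n m d) (i : Fin n) : ℕ := (B.edgesVM.filter (fun e => e.1 = i)).card

/-- Number of connections of a middle node. -/
def degM (B : DBM n m d) (j : Fin m) : ℕ :=
  (B.edgesVM.filter (fun e => e.2 = j)).card + (B.edgesMD.filter (fun e => e.1 = j)).card

/-- Number of connections of a deep node. -/
def degD (B : DBM n m d) (l : Fin d) : ℕ := (B.edgesMD.filter (fun e => e.2 = l)).card

/-- Each node (visible, middle, deep) has at most `D` connections. -/
def DegreeLE (B : DBM n m d) (D : ℕ) : Prop :=
  (∀ i, B.degV i ≤ D) ∧ (∀ j, B.degM j ≤ D) ∧ (∀ l, B.degD l ≤ D)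

/-- `B` represents the state `ψ` to precision `ε` in distribution. -/
def Represents (B : DBM n m d) (ψ : QState n) (ε : ℝ) : Prop :=
  tvDist B.dist (stateDist ψ) ≤ ε

end DBM

end

/-! The ground state is approached by applying local gates to `|+⟩`, and each gate is absorbed into
the network at a fixed cost. For a term `H_a` with ground energy `E_a`, let `K_a = (H_a - E_a) /
(2J)` (`rescaled`). The norm bound gives `0 ≤ K_a ≤ 1`, and stoquasticity then makes the gate `1 -
K_a` entrywise non-negative (`one_sub_rescaled_entries`). By frustration-freeness every gate fixes
the ground space of `H` and preserves its orthogonal complement. There a sweep through all `L` gates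
shrinks the squared norm by a factor at most `1 - Δ / (2JL²)`, a form of the detectability lemma
(`gateProd_loss`, `norm_gateProd_sq_le`). So about `L² J Δ⁻¹ log(1 / (ηε))` sweeps bring `|+⟩` to
within a small multiple of `ηε` of `Π|+⟩`. With the middle layer summed out, a network computes a
sum over deep configurations of a product of factors `1 + exp(affine)`. To apply a non-negative
kernel on a set `S` of qubits, the visible nodes in `S` become deep, new visible nodes replace them,
and middle units between the two copies carry the kernel (`out_prepend`). One unit per pair of
patterns suffices in the limit of large weights (`tendsto_factor_patternFamily`), so a gate costs at
most `2^(2k) + k` hidden nodes, and the `L` gates of a sweep supply the third power of `L`. Limits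
are handled by working in the closure of the realisable functions until the end. Two copies glued
along the visible nodes square the amplitudes into probabilities. Finally `η ≥ 2^(-n/2)`, because
taking absolute values of the amplitudes of a ground state gives another ground state. -/

/-! ### Networks with the middle layer summed out, and their products -/

/-- A bipartite network with `n` visible nodes, middle nodes `M` and deep nodes `D`, biased only on
the middle nodes. Edges are the pairs of nonzero weight. -/
structure LayeredNet (n : ℕ) (M D : Type) where
  /-- weights between the middle and the visible nodes -/
  wV : M → Fin n → ℝ
  /-- weights between the middle and the deep nodes -/
  wD : M → D → ℝ
  /-- biases of the middle nodes -/
  b : M → ℝ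

namespace LayeredNet

variable {n : ℕ} {M D M' D' : Type}

/-- The total input of a middle node. -/
noncomputable def input [Fintype D] (B : LayeredNet n M D) (x : Bits n) (g : D → Bool) (j : M) : ℝ :=
  B.b j + ∑ i, B.wV j i * bitVal (x i) + ∑ l, B.wD j l * bitVal (g l)

/-- The output, with the middle nodes summed out. -/
noncomputable def out [Fintype M] [Fintype D] [DecidableEq D] (B : LayeredNet n M D)
    (x : Bits n) : ℝ :=
  ∑ g : D → Bool, ∏ j, (1 + Real.exp (B.input x g j))

/-- Visible nodes have at most `Δv` connections and hidden nodes at most `Δh`. -/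
def DegBound (B : LayeredNet n M D) (Δv Δh : ℕ) : Prop :=
  (∀ i, Nat.card {j // B.wV j i ≠ 0} ≤ Δv) ∧
  (∀ l, Nat.card {j // B.wD j l ≠ 0} ≤ Δh) ∧
  (∀ j, Nat.card {i // B.wV j i ≠ 0} + Nat.card {l // B.wD j l ≠ 0} ≤ Δh)

/-- Two networks with the same visible nodes, side by side. -/
def glue (B : LayeredNet n M D) (B' : LayeredNet n M' D') : LayeredNet n (M ⊕ M') (D ⊕ D') where
  wV := Sum.elim B.wV B'.wV
  wD := Sum.elim (fun j => Sum.elim (B.wD j) 0) (fun j => Sum.elim 0 (B'.wD j))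
  b := Sum.elim B.b B'.b

/-- No edge joins the hidden nodes of the two networks, so the sum over deep configurations factors.
-/
theorem out_glue [Fintype M] [Fintype D] [DecidableEq D] [Fintype M'] [Fintype D'] [DecidableEq D']
    (B : LayeredNet n M D) (B' : LayeredNet n M' D') (x : Bits n) :
    (B.glue B').out x = B.out x * B'.out x := by
  unfold out
  rw [Finset.sum_mul_sum, ← Fintype.sum_prod_type',
    ← (Equiv.sumArrowEquivProdArrow D D' Bool).symm.sum_comp]
  refine Finset.sum_congr rfl fun g _ => ?_
  simp [Fintype.prod_sum_type, input, glue, Equiv.sumArrowEquivProdArrow]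

theorem card_sum_subtype {α β : Type*} [Finite α] [Finite β] (p : α ⊕ β → Prop) :
    Nat.card {v // p v} = Nat.card {a // p (Sum.inl a)} + Nat.card {b // p (Sum.inr b)} := by
  rw [Nat.card_congr Equiv.subtypeSum, Nat.card_sum]

theorem card_subtype_eq_zero {α : Type*} {p : α → Prop} (h : ∀ a, ¬ p a) :
    Nat.card {a // p a} = 0 := by
  have : IsEmpty {a // p a} := ⟨fun a => h a.1 a.2⟩
  exact Nat.card_of_isEmpty

theorem DegBound.glue [Finite M] [Finite D] [Finite M'] [Finite D']
    {B : LayeredNet n M D} {B' : LayeredNet n M' D'} {Δv Δv' Δh : ℕ}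
    (hB : B.DegBound Δv Δh) (hB' : B'.DegBound Δv' Δh) :
    (B.glue B').DegBound (Δv + Δv') Δh := by
  refine ⟨fun i => ?_, ?_, ?_⟩
  · rw [card_sum_subtype]
    exact add_le_add (hB.1 i) (hB'.1 i)
  · rintro (l | l) <;> rw [card_sum_subtype]
    · rw [card_subtype_eq_zero (p := fun b => (B.glue B').wD (Sum.inr b) (Sum.inl l) ≠ 0)
        (by simp [LayeredNet.glue])]
      exact hB.2.1 l
    · rw [card_subtype_eq_zero (p := fun b => (B.glue B').wD (Sum.inl b) (Sum.inr l) ≠ 0)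
        (by simp [LayeredNet.glue]), zero_add]
      exact hB'.2.1 l
  · rintro (j | j) <;> rw [card_sum_subtype (α := D)]
    · rw [card_subtype_eq_zero (p := fun b => (B.glue B').wD (Sum.inl j) (Sum.inr b) ≠ 0)
        (by simp [LayeredNet.glue])]
      exact hB.2.2 j
    · rw [card_subtype_eq_zero (p := fun b => (B.glue B').wD (Sum.inr j) (Sum.inl b) ≠ 0)
        (by simp [LayeredNet.glue]), zero_add]
      exact hB'.2.2 j

end LayeredNet

/-! ### Composing a network with a local kernel -/

/-- The parameters of a family of units `Z`, each seeing two groups of nodes `ι`. -/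
structure UnitFamily (Z ι : Type) where
  /-- weights of the first group -/
  wx : Z → ι → ℝ
  /-- weights of the second group -/
  wy : Z → ι → ℝ
  /-- biases -/
  b : Z → ℝ

/-- The product of the factors of the units. -/
noncomputable def UnitFamily.factor {Z ι : Type} [Fintype Z] [Fintype ι] (U : UnitFamily Z ι)
    (x y : ι → Bool) : ℝ :=
  ∏ z, (1 + Real.exp (U.b z + ∑ i, U.wx z i * bitVal (x i) + ∑ i, U.wy z i * bitVal (y i)))

/-- `x` with the bits in `S` replaced by `y`. -/
def replaceBits {n : ℕ} (S : Finset (Fin n)) (x : Bits n) (y : S → Bool) : Bits n :=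
  fun i => if h : i ∈ S then y ⟨i, h⟩ else x i

namespace LayeredNet

variable {n : ℕ} {M D Z : Type}

/-- Put a family of units between new visible nodes in `S` and the old ones, which become deep. -/
def prepend (B : LayeredNet n M D) (S : Finset (Fin n)) (U : UnitFamily Z S) :
    LayeredNet n (Z ⊕ M) (S ⊕ D) where
  wV := Sum.elim (fun z i => if h : i ∈ S then U.wx z ⟨i, h⟩ else 0)
    (fun j i => if i ∈ S then 0 else B.wV j i)
  wD := Sum.elim (fun z => Sum.elim (U.wy z) 0) (fun j => Sum.elim (fun s => B.wV j s) (B.wD j))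
  b := Sum.elim U.b B.b

theorem sum_dite_mem {n : ℕ} (S : Finset (Fin n)) (f : S → ℝ) (g : Fin n → ℝ) :
    (∑ i, (if h : i ∈ S then f ⟨i, h⟩ else 0) * g i) = ∑ s : S, f s * g s := by
  rw [← Finset.sum_subset (Finset.subset_univ S), ← Finset.sum_coe_sort]
  · exact Finset.sum_congr rfl fun s _ => by simp
  · intro i _ hi
    simp [hi]

/-- The new deep bits `y` sit where the old visible bits in `S` were, so the old middle nodes see
`replaceBits S x y`; summing over `y` composes the two layers. -/
theorem out_prepend [Fintype M] [Fintype D] [DecidableEq D] [Fintype Z]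
    (B : LayeredNet n M D) (S : Finset (Fin n)) (U : UnitFamily Z S) (x : Bits n) :
    (B.prepend S U).out x =
      ∑ y : S → Bool, U.factor (fun s => x s) y * B.out (replaceBits S x y) := by
  unfold out
  simp_rw [Finset.mul_sum]
  rw [← Fintype.sum_prod_type', ← (Equiv.sumArrowEquivProdArrow S D Bool).symm.sum_comp]
  refine Finset.sum_congr rfl fun g _ => ?_
  rw [Fintype.prod_sum_type]
  congr 1
  · unfold UnitFamily.factor
    refine Finset.prod_congr rfl fun z _ => ?_
    have h1 := sum_dite_mem S (U.wx z) (fun i => bitVal (x i))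
    simp only [input, prepend, Equiv.sumArrowEquivProdArrow, Sum.elim_inl, h1,
      Fintype.sum_sum_type, Equiv.coe_fn_symm_mk, Sum.elim_inr, Pi.zero_apply, zero_mul,
      Finset.sum_const_zero, add_zero]
  · refine Finset.prod_congr rfl fun j _ => ?_
    have h1 : ∑ i, B.wV j i * bitVal (replaceBits S x g.1 i) =
        ∑ i, (if i ∈ S then 0 else B.wV j i) * bitVal (x i) +
          ∑ s : S, B.wV j s * bitVal (g.1 s) := by
      have := sum_dite_mem S (fun s => B.wV j s * bitVal (g.1 s)) (fun _ => 1)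
      simp only [mul_one] at this
      rw [← this, ← Finset.sum_add_distrib]
      refine Finset.sum_congr rfl fun i _ => ?_
      by_cases hi : i ∈ S <;> simp [replaceBits, hi]
    simp only [input, prepend, Equiv.sumArrowEquivProdArrow, Sum.elim_inr, h1,
      Fintype.sum_sum_type, Equiv.coe_fn_symm_mk, Sum.elim_inl]
    congr 2
    ring

/-- Visible degrees do not accumulate: a node of `S` trades all its old neighbours for the new
units. Once deep, a node keeps at most `Δv` old edges, gains at most `Δv`, and is never touched
again. A new unit sees two copies of `S`; an old middle node only has edges redirected. -/
theorem DegBound.prepend [Finite M] [Finite D] [Finite Z]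
    {B : LayeredNet n M D} {S : Finset (Fin n)} {Δv Δh : ℕ} (hB : B.DegBound Δv Δh)
    (U : UnitFamily Z S) (hZ : Nat.card Z ≤ Δv) (hh : Δv + Δv ≤ Δh) (hS : 2 * S.card ≤ Δh) :
    (B.prepend S U).DegBound Δv Δh := by
  refine ⟨fun i => ?_, ?_, ?_⟩
  · rw [card_sum_subtype]
    by_cases hi : i ∈ S
    · rw [card_subtype_eq_zero (p := fun b => (B.prepend S U).wV (Sum.inr b) i ≠ 0)
        (by simp [LayeredNet.prepend, hi])]
      exact (Finite.card_subtype_le _).trans hZ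
    · rw [card_subtype_eq_zero (p := fun b => (B.prepend S U).wV (Sum.inl b) i ≠ 0)
        (by simp [LayeredNet.prepend, hi]), zero_add]
      simpa [LayeredNet.prepend, hi] using hB.1 i
  · rintro (l | l) <;> rw [card_sum_subtype]
    · exact (add_le_add ((Finite.card_subtype_le _).trans hZ) (hB.1 l)).trans hh
    · rw [card_subtype_eq_zero (p := fun b => (B.prepend S U).wD (Sum.inl b) (Sum.inr l) ≠ 0)
        (by simp [LayeredNet.prepend]), zero_add]
      exact hB.2.1 l
  · rintro (j | j) <;> rw [card_sum_subtype (α := S)]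
    · rw [card_subtype_eq_zero (p := fun b => (B.prepend S U).wD (Sum.inl j) (Sum.inr b) ≠ 0)
        (by simp [LayeredNet.prepend])]
      have h1 : Nat.card {i // (B.prepend S U).wV (Sum.inl j) i ≠ 0} ≤ Nat.card S := by
        refine Nat.card_le_card_of_injective
          (fun i => (⟨i.1, by
            by_contra hi
            exact i.2 (by simp [LayeredNet.prepend, hi])⟩ : S)) ?_
        intro a b hab
        simpa [Subtype.ext_iff] using hab
      have h2 := Finite.card_subtype_le
        (fun s : S => (B.prepend S U).wD (Sum.inl j) (Sum.inl s) ≠ 0)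
      have h3 : Nat.card S = S.card := by simp
      omega
    · rw [← add_assoc]
      refine le_trans (Nat.add_le_add_right ?_ _) (hB.2.2 j)
      rw [← Nat.card_sum]
      refine Nat.card_le_card_of_injective
        (Sum.elim (fun i => ⟨i.1, fun h0 => i.2 (by simp [LayeredNet.prepend, h0])⟩)
          (fun s => ⟨s.1, s.2⟩)) ?_
      have key : ∀ i : {i // (B.prepend S U).wV (Sum.inr j) i ≠ 0}, i.1 ∉ S := fun i hi =>
        i.2 (by simp [LayeredNet.prepend, hi])
      rintro (a | a) (b | b) hab <;> replace hab := congrArg Subtype.val hab <;>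
        simp only [Sum.elim_inl, Sum.elim_inr] at hab
      · exact congrArg _ (Subtype.ext hab)
      · exact absurd (hab ▸ b.1.2) (key a)
      · exact absurd (hab ▸ a.1.2) (key b)
      · exact congrArg _ (Subtype.ext (Subtype.ext hab))

/-! ### From networks to deep Boltzmann machines -/

/-- The deep Boltzmann machine of a network. -/
noncomputable def toDBM {m d : ℕ} (B : LayeredNet n (Fin m) (Fin d)) : DBM n m d where
  edgesVM := Finset.univ.filter fun e => B.wV e.2 e.1 ≠ 0
  edgesMD := Finset.univ.filter fun e => B.wD e.1 e.2 ≠ 0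
  weightVM i j := B.wV j i
  weightMD := B.wD
  biasV := 0
  biasM := B.b
  biasD := 0

theorem sum_exp_bits {M : Type} [Fintype M] [DecidableEq M] (t : M → ℝ) :
    ∑ h : M → Bool, Real.exp (∑ j, t j * bitVal (h j)) = ∏ j, (1 + Real.exp (t j)) := by
  have : ∀ j, 1 + Real.exp (t j) = ∑ b : Bool, Real.exp (t j * bitVal b) := by
    intro j
    simp [bitVal, add_comm]
  simp_rw [this, Finset.prod_univ_sum, Real.exp_sum, Fintype.piFinset_univ]

theorem output_toDBM {m d : ℕ} (B : LayeredNet n (Fin m) (Fin d)) (x : Bits n) :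
    B.toDBM.output x = B.out x := by
  unfold DBM.output out
  rw [Finset.sum_comm]
  refine Finset.sum_congr rfl fun g _ => ?_
  rw [← sum_exp_bits]
  refine Finset.sum_congr rfl fun h _ => ?_
  congr 1
  have h1 : ∑ e ∈ B.toDBM.edgesVM, B.toDBM.weightVM e.1 e.2 * bitVal (x e.1) * bitVal (h e.2) =
      ∑ j, (∑ i, B.wV j i * bitVal (x i)) * bitVal (h j) := by
    simp_rw [toDBM, Finset.sum_mul]
    rw [Finset.sum_filter_of_ne, Fintype.sum_prod_type_right]
    intro e _ he h0
    simp [h0] at he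
  have h2 : ∑ e ∈ B.toDBM.edgesMD, B.toDBM.weightMD e.1 e.2 * bitVal (h e.1) * bitVal (g e.2) =
      ∑ j, (∑ l, B.wD j l * bitVal (g l)) * bitVal (h j) := by
    simp_rw [toDBM, Finset.sum_mul]
    rw [Finset.sum_filter_of_ne, Fintype.sum_prod_type]
    · exact Finset.sum_congr rfl fun j _ => Finset.sum_congr rfl fun l _ => by ring
    intro e _ he h0
    simp [h0] at he
  rw [DBM.energy, h1, h2]
  simp only [toDBM, input, add_mul, Finset.sum_add_distrib, Pi.zero_apply, zero_mul,
    Finset.sum_const_zero]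
  ring

theorem DegBound.toDBM {m d K : ℕ} {B : LayeredNet n (Fin m) (Fin d)} (hB : B.DegBound K K) :
    B.toDBM.DegreeLE K := by
  have key : ∀ {α β : Type} [Fintype α] [Fintype β] (E : Finset α) (F : α → β) (p : β → Prop),
      Set.InjOn F E → (∀ e ∈ E, p (F e)) → E.card ≤ Nat.card {b // p b} := by
    intro α β _ _ E F p hF hp
    rw [← Fintype.card_coe, ← Nat.card_eq_fintype_card]
    refine Nat.card_le_card_of_injective (fun e : E => ⟨F e.1, hp e.1 e.2⟩) ?_
    intro a b hab
    exact Subtype.ext (hF a.2 b.2 (by simpa using hab))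
  refine ⟨fun i => (key _ Prod.snd _ ?_ ?_).trans (hB.1 i),
    fun j => (add_le_add (key _ Prod.fst _ ?_ ?_) (key _ Prod.snd _ ?_ ?_)).trans (hB.2.2 j),
    fun l => (key _ Prod.fst _ ?_ ?_).trans (hB.2.1 l)⟩
  all_goals
    simp only [LayeredNet.toDBM, Finset.mem_filter, Finset.mem_univ, true_and, Set.InjOn,
      Finset.mem_coe, Prod.forall]
    aesop

/-- Relabelling of the hidden nodes. -/
def relabel {M' D' : Type} (B : LayeredNet n M D) (e : M' ≃ M) (f : D' ≃ D) :
    LayeredNet n M' D' where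
  wV j := B.wV (e j)
  wD j l := B.wD (e j) (f l)
  b j := B.b (e j)

theorem out_relabel {M' D' : Type} [Fintype M] [Fintype D] [DecidableEq D] [Fintype M'] [Fintype D']
    [DecidableEq D'] (B : LayeredNet n M D) (e : M' ≃ M) (f : D' ≃ D) (x : Bits n) :
    (B.relabel e f).out x = B.out x := by
  unfold out
  rw [← (f.arrowCongr (Equiv.refl Bool)).sum_comp]
  refine Finset.sum_congr rfl fun g _ => ?_
  rw [← e.prod_comp]
  refine Finset.prod_congr rfl fun j _ => ?_
  unfold input
  rw [← f.sum_comp]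
  simp [relabel, Equiv.arrowCongr]

theorem DegBound.relabel {M' D' : Type} {B : LayeredNet n M D} {Δv Δh : ℕ} (hB : B.DegBound Δv Δh)
    (e : M' ≃ M) (f : D' ≃ D) : (B.relabel e f).DegBound Δv Δh := by
  refine ⟨fun i => ?_, fun l => ?_, fun j => ?_⟩
  · rw [Nat.card_congr (e.subtypeEquiv (p := fun j => (B.relabel e f).wV j i ≠ 0)
      (q := fun j => B.wV j i ≠ 0) fun _ => Iff.rfl)]
    exact hB.1 i
  · rw [Nat.card_congr (e.subtypeEquiv (p := fun j => (B.relabel e f).wD j l ≠ 0)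
      (q := fun j => B.wD j (f l) ≠ 0) fun _ => Iff.rfl)]
    exact hB.2.1 (f l)
  · rw [Nat.card_congr (f.subtypeEquiv (p := fun l => (B.relabel e f).wD j l ≠ 0)
      (q := fun l => B.wD (e j) l ≠ 0) fun _ => Iff.rfl)]
    exact hB.2.2 (e j)

end LayeredNet

/-! ### Realisable functions up to scale -/

/-- The functions that are, up to a positive factor, the output of a network with at most `N` hidden
nodes and the given degree bounds. -/
def netFun (n Δv Δh N : ℕ) : Set (Bits n → ℝ) :=
  {f | ∃ (M D : Type) (_ : Fintype M) (_ : Fintype D) (_ : DecidableEq D) (B : LayeredNet n M D)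
    (c : ℝ), 0 < c ∧ (∀ x, f x = c * B.out x) ∧ Nat.card M + Nat.card D ≤ N ∧ B.DegBound Δv Δh}

theorem const_mem_netFun (n Δv Δh N : ℕ) {c : ℝ} (hc : 0 < c) :
    (fun _ => c) ∈ netFun n Δv Δh N := by
  refine ⟨Empty, Empty, inferInstance, inferInstance, inferInstance,
    ⟨Empty.elim, Empty.elim, Empty.elim⟩, c, hc, fun x => ?_, by simp, ?_, ?_, ?_⟩
  · simp [LayeredNet.out]
  all_goals simp

theorem netFun_mul {n Δv Δv' Δh N N' : ℕ} {f f' : Bits n → ℝ} (hf : f ∈ netFun n Δv Δh N)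
    (hf' : f' ∈ netFun n Δv' Δh N') : f * f' ∈ netFun n (Δv + Δv') Δh (N + N') := by
  obtain ⟨M, D, _, _, _, B, c, hc, h1, h2, h3⟩ := hf
  obtain ⟨M', D', _, _, _, B', c', hc', h1', h2', h3'⟩ := hf'
  refine ⟨M ⊕ M', D ⊕ D', inferInstance, inferInstance, inferInstance, B.glue B', c * c',
    mul_pos hc hc', fun x => ?_, ?_, h3.glue h3'⟩
  · rw [Pi.mul_apply, h1, h1', LayeredNet.out_glue]
    ring
  · rw [Nat.card_sum, Nat.card_sum]
    omega

/-- The positive multiples of factors of families of units `Z`. -/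
def factorFun (Z ι : Type) [Fintype Z] [Fintype ι] : Set ((ι → Bool) → (ι → Bool) → ℝ) :=
  {q | ∃ (U : UnitFamily Z ι) (c : ℝ), 0 < c ∧ ∀ x y, q x y = c * U.factor x y}

/-- The action of a local kernel on functions of bit strings. -/
def localAct {n : ℕ} (S : Finset (Fin n)) (q : (S → Bool) → (S → Bool) → ℝ) (f : Bits n → ℝ) :
    Bits n → ℝ :=
  fun x => ∑ y : S → Bool, q (fun s => x s) y * f (replaceBits S x y)

theorem netFun_localAct {n Δv Δh N : ℕ} {Z : Type} [Fintype Z] {S : Finset (Fin n)}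
    {q : (S → Bool) → (S → Bool) → ℝ} {f : Bits n → ℝ} (hq : q ∈ factorFun Z S)
    (hf : f ∈ netFun n Δv Δh N) (hZ : Nat.card Z ≤ Δv) (hh : Δv + Δv ≤ Δh)
    (hS : 2 * S.card ≤ Δh) :
    localAct S q f ∈ netFun n Δv Δh (N + (Nat.card Z + S.card)) := by
  obtain ⟨M, D, _, _, _, B, c, hc, h1, h2, h3⟩ := hf
  obtain ⟨U, c', hc', hU⟩ := hq
  refine ⟨Z ⊕ M, S ⊕ D, inferInstance, inferInstance, inferInstance, B.prepend S U, c * c',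
    mul_pos hc hc', fun x => ?_, ?_, h3.prepend U hZ hh hS⟩
  · rw [LayeredNet.out_prepend, Finset.mul_sum]
    refine Finset.sum_congr rfl fun y _ => ?_
    rw [hU, h1]
    ring
  · have : Nat.card S = S.card := by simp
    rw [Nat.card_sum, Nat.card_sum]
    omega

theorem exists_dbm_of_mem_netFun {n K N : ℕ} {f : Bits n → ℝ} (hf : f ∈ netFun n K K N) :
    ∃ (m d : ℕ) (B : DBM n m d), m + d ≤ N ∧ B.DegreeLE K ∧ ∀ x, B.dist x = f x / ∑ y, f y := by
  obtain ⟨M, D, _, _, _, B, c, hc, h1, h2, h3⟩ := hf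
  refine ⟨Fintype.card M, Fintype.card D,
    (B.relabel (Fintype.equivFin M).symm (Fintype.equivFin D).symm).toDBM, by simpa using h2,
    (h3.relabel _ _).toDBM, fun x => ?_⟩
  simp only [DBM.dist, LayeredNet.output_toDBM, LayeredNet.out_relabel, h1]
  rw [← Finset.mul_sum, mul_div_mul_left _ _ hc.ne']

/-! ### Limits of realisable functions -/

section Closure

open Filter Topology

/-- The number of nodes at which `x` differs from the pattern `z`, as an affine function of the
values of `x`. -/
theorem sum_pattern {ι : Type} [Fintype ι] (z x : ι → Bool) :
    -(∑ i, bitVal (z i)) + ∑ i, (2 * bitVal (z i) - 1) * bitVal (x i) =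
      -∑ i, (if x i = z i then (0 : ℝ) else 1) := by
  rw [← Finset.sum_neg_distrib, ← Finset.sum_neg_distrib, ← Finset.sum_add_distrib]
  refine Finset.sum_congr rfl fun i _ => ?_
  cases z i <;> cases x i <;> norm_num [bitVal]

/-- One unit for each pattern, which prefers this pattern with strength `K`. -/
noncomputable def patternFamily {ι : Type} [Fintype ι] (β : (ι → Bool) → (ι → Bool) → ℝ) (K : ℝ) :
    UnitFamily ((ι → Bool) × (ι → Bool)) ι where
  wx z i := K * (2 * bitVal (z.1 i) - 1)
  wy z i := K * (2 * bitVal (z.2 i) - 1)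
  b z := β z.1 z.2 - K * (∑ i, bitVal (z.1 i)) - K * (∑ i, bitVal (z.2 i))

/-- The unit of pattern `z` has input `β z - K * e`, where `e` counts the disagreements with `z`. As
`K` grows, every unit but the matching one contributes a factor tending to `1`. -/
theorem tendsto_factor_patternFamily {ι : Type} [Fintype ι] [DecidableEq ι]
    (β : (ι → Bool) → (ι → Bool) → ℝ) (x y : ι → Bool) :
    Tendsto (fun K => (patternFamily β K).factor x y) atTop (𝓝 (1 + Real.exp (β x y))) := by
  have h : ∀ z ∈ (Finset.univ : Finset ((ι → Bool) × (ι → Bool))),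
      Tendsto (fun K => 1 + Real.exp ((patternFamily β K).b z +
        ∑ i, (patternFamily β K).wx z i * bitVal (x i) +
        ∑ i, (patternFamily β K).wy z i * bitVal (y i))) atTop
        (𝓝 (if z = (x, y) then 1 + Real.exp (β x y) else 1)) := by
    intro z _
    set e : ℝ := ∑ i, (if x i = z.1 i then (0 : ℝ) else 1) + ∑ i, (if y i = z.2 i then (0 : ℝ) else 1)
      with he
    have h1 : ∀ K, (patternFamily β K).b z + ∑ i, (patternFamily β K).wx z i * bitVal (x i) +
        ∑ i, (patternFamily β K).wy z i * bitVal (y i) = β z.1 z.2 - K * e := by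
      intro K
      have hx := sum_pattern z.1 x
      have hy := sum_pattern z.2 y
      simp only [patternFamily, mul_assoc, ← Finset.mul_sum]
      linear_combination K * hx + K * hy
    simp_rw [h1]
    by_cases hz : z = (x, y)
    · have : e = 0 := by simp [he, hz]
      simp [this, hz]
    · rw [if_neg hz]
      have hpos : 0 < e := by
        have hx0 : ∀ i ∈ (Finset.univ : Finset ι), (0 : ℝ) ≤ if x i = z.1 i then (0 : ℝ) else 1 :=
          fun i _ => by split_ifs <;> norm_num
        have hy0 : ∀ i ∈ (Finset.univ : Finset ι), (0 : ℝ) ≤ if y i = z.2 i then (0 : ℝ) else 1 :=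
          fun i _ => by split_ifs <;> norm_num
        have hne : x ≠ z.1 ∨ y ≠ z.2 := by
          by_contra hcon
          push Not at hcon
          exact hz (Prod.ext hcon.1.symm hcon.2.symm)
        rcases hne with hne | hne
        · obtain ⟨i, hi⟩ := Function.ne_iff.mp hne
          exact add_pos_of_pos_of_nonneg
            (Finset.sum_pos' hx0 ⟨i, Finset.mem_univ i, by simp [hi]⟩) (Finset.sum_nonneg hy0)
        · obtain ⟨i, hi⟩ := Function.ne_iff.mp hne
          exact add_pos_of_nonneg_of_pos (Finset.sum_nonneg hx0)
            (Finset.sum_pos' hy0 ⟨i, Finset.mem_univ i, by simp [hi]⟩)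
      have h2 : Tendsto (fun K : ℝ => β z.1 z.2 - K * e) atTop atBot :=
        tendsto_atBot_add_const_left _ _
          (tendsto_neg_atTop_atBot.comp (tendsto_id.atTop_mul_const hpos))
      simpa using (Real.tendsto_exp_atBot.comp h2).const_add 1
  have := tendsto_finsetProd _ h
  simpa [UnitFamily.factor] using this

/-- Limiting factors `1 + exp β` always exceed `1`. Scaling by half the minimum of `q` makes all
entries of `q / c` at least `2`, so `β = log (q / c - 1)` is defined. -/
theorem mem_closure_factorFun_of_pos {ι : Type} [Fintype ι] [DecidableEq ι]
    {q : (ι → Bool) → (ι → Bool) → ℝ} (hq : ∀ x y, 0 < q x y) :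
    q ∈ closure (factorFun ((ι → Bool) × (ι → Bool)) ι) := by
  obtain ⟨z, hz⟩ := Finite.exists_min (fun p : (ι → Bool) × (ι → Bool) => q p.1 p.2)
  set c := q z.1 z.2 / 2 with hc
  have hc0 : 0 < c := half_pos (hq _ _)
  have hlt : ∀ x y, 0 < q x y / c - 1 := by
    intro x y
    have h1 := hz (x, y)
    rw [sub_pos, one_lt_div hc0]
    have := hq z.1 z.2
    simp only at h1
    linarith
  refine mem_closure_of_tendsto (f := fun K x y =>
    c * (patternFamily (fun x y => Real.log (q x y / c - 1)) K).factor x y) (b := atTop) ?_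
    (Eventually.of_forall fun K => ⟨_, c, hc0, fun _ _ => rfl⟩)
  refine tendsto_pi_nhds.mpr fun x => tendsto_pi_nhds.mpr fun y => ?_
  have := (tendsto_factor_patternFamily (fun x y => Real.log (q x y / c - 1)) x y).const_mul c
  rw [Real.exp_log (hlt x y)] at this
  convert this using 2
  field_simp
  ring

theorem mem_closure_factorFun {ι : Type} [Fintype ι] [DecidableEq ι]
    {q : (ι → Bool) → (ι → Bool) → ℝ} (hq : ∀ x y, 0 ≤ q x y) :
    q ∈ closure (factorFun ((ι → Bool) × (ι → Bool)) ι) := by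
  rw [← closure_closure]
  refine mem_closure_of_tendsto (f := fun (δ : ℝ) x y => q x y + δ) (b := 𝓝[>] 0) ?_ ?_
  · refine tendsto_pi_nhds.mpr fun x => tendsto_pi_nhds.mpr fun y => ?_
    have : Tendsto (fun δ : ℝ => q x y + δ) (𝓝 0) (𝓝 (q x y + 0)) :=
      tendsto_id.const_add _
    rw [add_zero] at this
    exact this.mono_left nhdsWithin_le_nhds
  · filter_upwards [self_mem_nhdsWithin] with δ hδ
    exact mem_closure_factorFun_of_pos fun x y => add_pos_of_nonneg_of_pos (hq x y) hδ

/-- The cost is one unit per pair of patterns plus the nodes of `S` turned deep: at most `2^(2k) +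
k`, rounded up to `2 * 2^(2k)`. -/
theorem closure_netFun_localAct {n k N : ℕ} {S : Finset (Fin n)} (hS : S.card ≤ k)
    {q : (S → Bool) → (S → Bool) → ℝ} {f : Bits n → ℝ} (hq : ∀ x y, 0 ≤ q x y)
    (hf : f ∈ closure (netFun n (2 ^ (2 * k)) (2 ^ (2 * k + 1)) N)) :
    localAct S q f ∈
      closure (netFun n (2 ^ (2 * k)) (2 ^ (2 * k + 1)) (N + 2 * 2 ^ (2 * k))) := by
  refine map_mem_closure₂ (f := localAct S) ?_ (mem_closure_factorFun hq) hf
    fun q' hq' f' hf' => ?_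
  · refine continuous_pi fun x => continuous_finsetSum _ fun y _ => ?_
    refine Continuous.mul ?_ ?_ <;> fun_prop
  · have hZ : Nat.card ((S → Bool) × (S → Bool)) ≤ 2 ^ (2 * k) := by
      simp only [Nat.card_eq_fintype_card, Fintype.card_prod, Fintype.card_fun, Fintype.card_bool,
        Fintype.card_coe, ← pow_add]
      exact Nat.pow_le_pow_right two_pos (by omega)
    have hk : 2 * k < 2 ^ (2 * k) := Nat.lt_two_pow_self
    have hp : 2 ^ (2 * k + 1) = 2 * 2 ^ (2 * k) := by ring
    obtain ⟨M, D, i1, i2, i3, B, c, hc, h1, h2, h3⟩ :=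
      netFun_localAct hq' hf' hZ (by omega) (by omega)
    exact ⟨M, D, i1, i2, i3, B, c, hc, h1, h2.trans (by omega), h3⟩

theorem closure_netFun_sq {n k N : ℕ} {f : Bits n → ℝ}
    (hf : f ∈ closure (netFun n (2 ^ (2 * k)) (2 ^ (2 * k + 1)) N)) :
    f * f ∈ closure (netFun n (2 ^ (2 * k + 1)) (2 ^ (2 * k + 1)) (2 * N)) := by
  refine map_mem_closure₂ (f := (· * ·)) continuous_mul hf hf fun a ha b hb => ?_
  have := netFun_mul ha hb
  rwa [← two_mul, ← two_mul, ← pow_succ'] at this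

/-- The normalised distance is continuous at `f`, and a strict inequality is an open condition, so
it survives at a genuinely realisable function near `f`. -/
theorem exists_dbm_of_mem_closure_netFun {n K N : ℕ} {f : Bits n → ℝ}
    (hf : f ∈ closure (netFun n K K N)) (hf0 : ∑ y, f y ≠ 0) {p : Bits n → ℝ} {ε : ℝ}
    (hp : tvDist (fun x => f x / ∑ y, f y) p < ε) :
    ∃ (m d : ℕ) (B : DBM n m d), m + d ≤ N ∧ B.DegreeLE K ∧ tvDist B.dist p ≤ ε := by
  have hcont : ContinuousAt (fun u : Bits n → ℝ => tvDist (fun x => u x / ∑ y, u y) p) f := by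
    unfold tvDist
    refine ContinuousAt.mul continuousAt_const (tendsto_finsetSum _ fun x _ => ?_)
    refine ContinuousAt.abs (ContinuousAt.sub (ContinuousAt.div ?_ ?_ hf0) continuousAt_const)
    · exact (continuous_apply x).continuousAt
    · exact (continuous_finsetSum _ fun y _ => continuous_apply y).continuousAt
  obtain ⟨u, hu, hu'⟩ := (mem_closure_iff_nhds.mp hf) _ (hcont.eventually_lt_const hp)
  obtain ⟨m, d, B, h1, h2, h3⟩ := exists_dbm_of_mem_netFun hu'
  exact ⟨m, d, B, h1, h2, (funext h3 ▸ le_of_lt hu : tvDist B.dist p ≤ ε)⟩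

end Closure

/-! ### Contraction by a sweep of gates -/

section Detectability

variable {E : Type*} [NormedAddCommGroup E] [InnerProductSpace ℂ E]

/-- The quadratic form of an operator. -/
noncomputable def quadForm (K : E →ₗ[ℂ] E) (x : E) : ℝ := (inner ℂ (K x) x).re

/-- Symmetric operators between `0` and `1`. -/
structure IsEffect (K : E →ₗ[ℂ] E) : Prop where
  symm : K.IsSymmetric
  nonneg : ∀ x, 0 ≤ quadForm K x
  le : ∀ x, quadForm K x ≤ ‖x‖ ^ 2

theorem LinearMap.IsSymmetric.re_inner_comm {K : E →ₗ[ℂ] E} (hK : K.IsSymmetric) (x y : E) :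
    (inner ℂ (K x) y).re = (inner ℂ (K y) x).re := by
  rw [hK x y]
  exact inner_re_symm (𝕜 := ℂ) x (K y)

theorem quadForm_add {K : E →ₗ[ℂ] E} (hK : K.IsSymmetric) (x y : E) :
    quadForm K (x + y) = quadForm K x + 2 * (inner ℂ (K x) y).re + quadForm K y := by
  have := hK.re_inner_comm x y
  simp only [quadForm, map_add, inner_add_left, inner_add_right, Complex.add_re]
  linarith

theorem quadForm_smul (K : E →ₗ[ℂ] E) (c : ℝ) (x : E) :
    quadForm K ((c : ℂ) • x) = c ^ 2 * quadForm K x := by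
  simp only [quadForm, map_smul, inner_smul_left, inner_smul_right, Complex.conj_ofReal,
    Complex.re_ofReal_mul]
  ring

/-- This is `K² ≤ K`, read off from non-negativity of the form at `x - K x`. -/
theorem IsEffect.norm_sq_le {K : E →ₗ[ℂ] E} (hK : IsEffect K) (x : E) :
    ‖K x‖ ^ 2 ≤ quadForm K x := by
  have h1 := hK.nonneg (x + ((-1 : ℝ) : ℂ) • K x)
  rw [quadForm_add hK.symm, quadForm_smul, inner_smul_right, Complex.re_ofReal_mul] at h1
  have h2 := hK.le (K x)
  have h3 : (inner ℂ (K x) (K x)).re = ‖K x‖ ^ 2 := inner_self_eq_norm_sq (𝕜 := ℂ) _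
  rw [h3] at h1
  linarith

theorem IsEffect.norm_sub_sq_le {K : E →ₗ[ℂ] E} (hK : IsEffect K) (x : E) :
    ‖x - K x‖ ^ 2 ≤ ‖x‖ ^ 2 - quadForm K x := by
  have h1 := norm_sub_sq (𝕜 := ℂ) x (K x)
  have h2 := hK.norm_sq_le x
  have h3 : RCLike.re (inner ℂ x (K x)) = quadForm K x := inner_re_symm (𝕜 := ℂ) _ _
  rw [h1, h3]
  linarith

theorem isEffect_id : IsEffect (LinearMap.id : E →ₗ[ℂ] E) := by
  have h : ∀ x : E, quadForm LinearMap.id x = ‖x‖ ^ 2 := fun x =>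
    inner_self_eq_norm_sq (𝕜 := ℂ) x
  exact ⟨LinearMap.IsSymmetric.id, fun x => h x ▸ sq_nonneg _, fun x => (h x).le⟩

/-- Weighted Young inequality, from non-negativity of the form at `m u - w`. The weights are chosen
so that the constant goes from `m` to `m + 1`, as an induction on the number of gates requires. -/
theorem IsEffect.quadForm_add_le {K : E →ₗ[ℂ] E} (hK : IsEffect K) {m : ℕ} {P : ℝ} (hP : 0 ≤ P)
    (u w : E) (hw : ‖w‖ ^ 2 ≤ m * P) :
    quadForm K (u + w) ≤ (m + 1) * (quadForm K u + P) := by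
  rcases Nat.eq_zero_or_pos m with rfl | hm
  · have hw0 : w = 0 := by
      have : ‖w‖ ^ 2 ≤ 0 := by simpa using hw
      simpa using le_antisymm this (sq_nonneg _)
    subst hw0
    simpa using hP
  · have h1 := hK.nonneg (((m : ℝ) : ℂ) • u + ((-1 : ℝ) : ℂ) • w)
    rw [quadForm_add hK.symm, quadForm_smul, quadForm_smul, map_smul, inner_smul_left,
      inner_smul_right, Complex.conj_ofReal, Complex.re_ofReal_mul, Complex.re_ofReal_mul] at h1
    have h2 := hK.le w
    rw [quadForm_add hK.symm]
    have hm' : (0 : ℝ) < m := Nat.cast_pos.mpr hm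
    have h3 : 2 * (inner ℂ (K u) w).re ≤ m * quadForm K u + P := by
      refine le_of_mul_le_mul_left ?_ hm'
      nlinarith
    nlinarith

/-- The product of the `1 - K a` over a list. -/
noncomputable def gateProd {ι : Type*} (K : ι → Module.End ℂ E) (l : List ι) : Module.End ℂ E :=
  (l.map fun a => 1 - K a).prod

theorem gateProd_nil {ι : Type*} (K : ι → Module.End ℂ E) (x : E) : gateProd K [] x = x := by
  simp [gateProd]

theorem gateProd_cons {ι : Type*} (K : ι → Module.End ℂ E) (a : ι) (l : List ι) (x : E) :
    gateProd K (a :: l) x = gateProd K l x - K a (gateProd K l x) := by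
  simp [gateProd]

/-- If the sweep loses little norm, each gate met a vector of little energy for its term, and that
vector lies close to `x`; `quadForm_add_le` carries the energy bound back to `x`. The displacement
bound is the same inequality for the identity, and is what the induction feeds on. The head of the
list acts last. -/
theorem gateProd_loss {ι : Type*} {K : ι → Module.End ℂ E} (hK : ∀ a, IsEffect (K a)) (x : E)
    (l : List ι) :
    0 ≤ ‖x‖ ^ 2 - ‖gateProd K l x‖ ^ 2 ∧
    ‖x - gateProd K l x‖ ^ 2 ≤ l.length * (‖x‖ ^ 2 - ‖gateProd K l x‖ ^ 2) ∧
    ∀ a ∈ l, quadForm (K a) x ≤ l.length * (‖x‖ ^ 2 - ‖gateProd K l x‖ ^ 2) := by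
  induction l with
  | nil => simp [gateProd_nil]
  | cons a l ih =>
    obtain ⟨h0, h1, h2⟩ := ih
    rw [gateProd_cons]
    set u := gateProd K l x with hu
    have hloss := (hK a).norm_sub_sq_le u
    have hq := (hK a).nonneg u
    have hlen : ((a :: l).length : ℝ) = l.length + 1 := by simp
    have hl : (0 : ℝ) ≤ l.length := Nat.cast_nonneg _
    rw [hlen]
    refine ⟨by linarith, ?_, ?_⟩
    · have h3 := isEffect_id.quadForm_add_le h0 (K a u) (x - u) h1
      have hid : ∀ y : E, quadForm LinearMap.id y = ‖y‖ ^ 2 := fun y =>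
        inner_self_eq_norm_sq (𝕜 := ℂ) y
      rw [hid, hid] at h3
      have h4 := (hK a).norm_sq_le u
      rw [show x - (u - K a u) = K a u + (x - u) by abel]
      refine h3.trans (mul_le_mul_of_nonneg_left ?_ (by linarith))
      linarith
    · intro b hb
      rcases List.mem_cons.mp hb with rfl | hb
      · have h3 := (hK b).quadForm_add_le h0 u (x - u) h1
        rw [add_sub_cancel] at h3
        refine h3.trans (mul_le_mul_of_nonneg_left ?_ (by linarith))
        linarith
      · have h3 := h2 b hb
        nlinarith

/-- The detectability lemma: a sweep of gates contracts vectors of large energy. -/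
theorem norm_gateProd_sq_le {L : ℕ} {K : Fin L → Module.End ℂ E} (hK : ∀ a, IsEffect (K a))
    {g : ℝ} {x : E} (hg : g * ‖x‖ ^ 2 ≤ ∑ a, quadForm (K a) x) :
    g * ‖x‖ ^ 2 ≤ (L : ℝ) ^ 2 * (‖x‖ ^ 2 - ‖gateProd K (List.finRange L) x‖ ^ 2) := by
  obtain ⟨-, -, h2⟩ := gateProd_loss hK x (List.finRange L)
  refine hg.trans ((Finset.sum_le_sum fun a _ => h2 a (List.mem_finRange a)).trans_eq ?_)
  simp
  ring

theorem gateProd_mem {ι : Type*} {K : ι → Module.End ℂ E} {W : Submodule ℂ E}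
    (hW : ∀ a, ∀ x ∈ W, K a x ∈ W) (l : List ι) {x : E} (hx : x ∈ W) : gateProd K l x ∈ W := by
  induction l with
  | nil => rwa [gateProd_nil]
  | cons a l ih =>
    rw [gateProd_cons]
    exact W.sub_mem ih (hW a _ ih)

theorem gateProd_of_ker {ι : Type*} {K : ι → Module.End ℂ E} {x : E} (hx : ∀ a, K a x = 0)
    (l : List ι) : gateProd K l x = x := by
  induction l with
  | nil => rw [gateProd_nil]
  | cons a l ih => rw [gateProd_cons, ih, hx, sub_zero]

theorem norm_gateProd_pow_sq_le {L : ℕ} (hL : 0 < L) {K : Fin L → Module.End ℂ E}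
    (hK : ∀ a, IsEffect (K a)) {W : Submodule ℂ E} (hW : ∀ a, ∀ x ∈ W, K a x ∈ W) {g : ℝ}
    (hg : ∀ x ∈ W, g * ‖x‖ ^ 2 ≤ ∑ a, quadForm (K a) x) (T : ℕ) {x : E} (hx : x ∈ W) :
    (gateProd K (List.finRange L) ^ T) x ∈ W ∧
      ‖(gateProd K (List.finRange L) ^ T) x‖ ^ 2 ≤ Real.exp (-(g / (L : ℝ) ^ 2) * T) * ‖x‖ ^ 2 := by
  induction T with
  | zero => simpa using hx
  | succ T ih =>
    obtain ⟨h1, h2⟩ := ih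
    rw [pow_succ', Module.End.mul_apply]
    set y := (gateProd K (List.finRange L) ^ T) x
    refine ⟨gateProd_mem hW _ h1, ?_⟩
    have h3 := norm_gateProd_sq_le hK (hg y h1)
    have hL2 : (0 : ℝ) < (L : ℝ) ^ 2 := by positivity
    have h4 : ‖gateProd K (List.finRange L) y‖ ^ 2 ≤ (1 - g / (L : ℝ) ^ 2) * ‖y‖ ^ 2 := by
      have : g / (L : ℝ) ^ 2 * ‖y‖ ^ 2 ≤ ‖y‖ ^ 2 - ‖gateProd K (List.finRange L) y‖ ^ 2 := by
        rw [div_mul_eq_mul_div, div_le_iff₀ hL2]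
        linarith
      linarith
    have h5 : 1 - g / (L : ℝ) ^ 2 ≤ Real.exp (-(g / (L : ℝ) ^ 2)) := by
      have := Real.add_one_le_exp (-(g / (L : ℝ) ^ 2))
      linarith
    calc _ ≤ _ := h4
      _ ≤ Real.exp (-(g / (L : ℝ) ^ 2)) * ‖y‖ ^ 2 := mul_le_mul_of_nonneg_right h5 (sq_nonneg _)
      _ ≤ Real.exp (-(g / (L : ℝ) ^ 2)) * (Real.exp (-(g / (L : ℝ) ^ 2) * T) * ‖x‖ ^ 2) :=
        mul_le_mul_of_nonneg_left h2 (Real.exp_pos _).le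
      _ = _ := by
        rw [← mul_assoc, ← Real.exp_add]
        congr 2
        push_cast
        ring

end Detectability

/-! ### Ground energy, gap and overlap with the uniform state -/

section Spectral

variable {n : ℕ}

open Matrix

theorem Matrix.IsHermitian.toEuclideanLin_eigenvectorBasis {A : QOp n} (hA : A.IsHermitian)
    (i : Bits n) :
    toEuclideanLin A (hA.eigenvectorBasis i) =
      (hA.eigenvalues i : ℂ) • hA.eigenvectorBasis i := by
  have h := hA.mulVec_eigenvectorBasis i
  ext x
  have := congrFun h x
  simpa [toLpLin_apply] using this

theorem Matrix.IsHermitian.isSymmetric_lin {A : QOp n} (hA : A.IsHermitian) :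
    (toEuclideanLin A).IsSymmetric :=
  isSymmetric_toEuclideanLin_iff.mpr hA

theorem eigenvalues_mem_energies {A : QOp n} (hA : A.IsHermitian) (i : Bits n) :
    hA.eigenvalues i ∈ energies A := by
  refine Module.End.hasEigenvalue_of_hasEigenvector (x := hA.eigenvectorBasis i)
    ⟨Module.End.mem_eigenspace_iff.mpr (hA.toEuclideanLin_eigenvectorBasis i), ?_⟩
  exact hA.eigenvectorBasis.orthonormal.ne_zero i

theorem finite_energies (A : QOp n) : (energies A).Finite :=
  (Module.End.finite_hasEigenvalue (toEuclideanLin A)).preimage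
    Complex.ofReal_injective.injOn

theorem groundEnergy_mem {A : QOp n} (hA : A.IsHermitian) : groundEnergy A ∈ energies A :=
  Set.Nonempty.csInf_mem ⟨_, eigenvalues_mem_energies hA fun _ => false⟩ (finite_energies A)

theorem exists_groundVector {A : QOp n} (hA : A.IsHermitian) : ∃ v ∈ groundSpace A, v ≠ 0 :=
  (Module.End.HasEigenvalue.exists_hasEigenvector (groundEnergy_mem hA)).imp fun _ h => h

theorem mem_groundSpace {A : QOp n} {v : QState n} :
    v ∈ groundSpace A ↔ toEuclideanLin A v = (groundEnergy A : ℂ) • v :=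
  Module.End.mem_eigenspace_iff

theorem quadForm_of_mem_groundSpace {A : QOp n} {v : QState n} (hv : v ∈ groundSpace A) :
    quadForm (toEuclideanLin A) v = groundEnergy A * ‖v‖ ^ 2 := by
  have h3 : (inner ℂ v v).re = ‖v‖ ^ 2 := inner_self_eq_norm_sq (𝕜 := ℂ) _
  rw [quadForm, mem_groundSpace.mp hv, inner_smul_left, Complex.conj_ofReal,
    Complex.re_ofReal_mul, h3]

theorem quadForm_eq_sum {A : QOp n} (hA : A.IsHermitian) (x : QState n) :
    quadForm (toEuclideanLin A) x =
      ∑ i, hA.eigenvalues i * ‖inner ℂ (hA.eigenvectorBasis i) x‖ ^ 2 := by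
  rw [quadForm, ← hA.eigenvectorBasis.sum_inner_mul_inner, Complex.re_sum]
  refine Finset.sum_congr rfl fun i _ => ?_
  rw [hA.isSymmetric_lin, hA.toEuclideanLin_eigenvectorBasis, inner_smul_right, mul_assoc,
    Complex.re_ofReal_mul, ← inner_conj_symm, ← Complex.normSq_eq_conj_mul_self,
    Complex.ofReal_re, Complex.normSq_eq_norm_sq]

theorem norm_sq_eq_sum {A : QOp n} (hA : A.IsHermitian) (x : QState n) :
    ‖x‖ ^ 2 = ∑ i, ‖inner ℂ (hA.eigenvectorBasis i) x‖ ^ 2 :=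
  (hA.eigenvectorBasis.sum_sq_norm_inner_right x).symm

theorem groundEnergy_mul_le {A : QOp n} (hA : A.IsHermitian) (x : QState n) :
    groundEnergy A * ‖x‖ ^ 2 ≤ quadForm (toEuclideanLin A) x := by
  rw [quadForm_eq_sum hA, norm_sq_eq_sum hA, Finset.mul_sum]
  exact Finset.sum_le_sum fun i _ => mul_le_mul_of_nonneg_right
    (csInf_le (finite_energies A).bddBelow (eigenvalues_mem_energies hA i)) (sq_nonneg _)

theorem HasEnergyGap.mul_le {A : QOp n} (hA : A.IsHermitian) {Δ : ℝ} (hΔ : HasEnergyGap A Δ)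
    {x : QState n} (hx : x ∈ (groundSpace A)ᗮ) :
    (groundEnergy A + Δ) * ‖x‖ ^ 2 ≤ quadForm (toEuclideanLin A) x := by
  rw [quadForm_eq_sum hA, norm_sq_eq_sum hA, Finset.mul_sum]
  refine Finset.sum_le_sum fun i _ => ?_
  by_cases hi : hA.eigenvalues i = groundEnergy A
  · have : hA.eigenvectorBasis i ∈ groundSpace A :=
      mem_groundSpace.mpr (hi ▸ hA.toEuclideanLin_eigenvectorBasis i)
    rw [hx _ this]
    simp
  · exact mul_le_mul_of_nonneg_right (hΔ.2 _ (eigenvalues_mem_energies hA i) hi) (sq_nonneg _)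

/-- Equality in the variational principle: the gap would charge any component orthogonal to the
ground space. -/
theorem mem_groundSpace_of_quadForm_le {A : QOp n} (hA : A.IsHermitian) {Δ : ℝ}
    (hΔ : HasEnergyGap A Δ) {x : QState n}
    (hx : quadForm (toEuclideanLin A) x ≤ groundEnergy A * ‖x‖ ^ 2) : x ∈ groundSpace A := by
  set p := (groundSpace A).starProjection x with hp
  have hpm : p ∈ groundSpace A := Submodule.starProjection_apply_mem _ _
  have hr : x - p ∈ (groundSpace A)ᗮ := Submodule.sub_starProjection_mem_orthogonal _
  have h0 : inner ℂ p (x - p) = 0 := hr p hpm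
  have h1 : quadForm (toEuclideanLin A) x = groundEnergy A * ‖p‖ ^ 2 +
      quadForm (toEuclideanLin A) (x - p) := by
    have := quadForm_add hA.isSymmetric_lin p (x - p)
    rw [add_sub_cancel, mem_groundSpace.mp hpm, inner_smul_left, h0,
      quadForm_of_mem_groundSpace hpm] at this
    simpa using this
  have h2 : ‖x‖ ^ 2 = ‖p‖ ^ 2 + ‖x - p‖ ^ 2 := by
    have := norm_add_sq_eq_norm_sq_add_norm_sq_of_inner_eq_zero p (x - p) h0
    rw [add_sub_cancel] at this
    simpa [sq] using this
  have h3 := hΔ.mul_le hA hr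
  have h4 : ‖x - p‖ ^ 2 ≤ 0 := by
    have := hΔ.1
    by_contra! hcon
    have h5 := mul_pos this hcon
    rw [h1, h2] at hx
    linarith
  have h5 : x - p = 0 := by simpa using le_antisymm h4 (sq_nonneg _)
  rw [sub_eq_zero.mp h5]
  exact hpm

theorem abs_quadForm_le_opNorm (A : QOp n) (x : QState n) :
    |quadForm (toEuclideanLin A) x| ≤ opNorm A * ‖x‖ ^ 2 := by
  have h1 : toEuclideanLin A x = toEuclideanCLM (𝕜 := ℂ) A x := by
    rw [← coe_toEuclideanCLM_eq_toEuclideanLin]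
    rfl
  rw [quadForm, h1]
  refine (Complex.abs_re_le_norm _).trans ((norm_inner_le_norm _ _).trans ?_)
  rw [sq, ← mul_assoc]
  exact mul_le_mul_of_nonneg_right (ContinuousLinearMap.le_opNorm _ _) (norm_nonneg _)

theorem abs_groundEnergy_le_opNorm {A : QOp n} (hA : A.IsHermitian) :
    |groundEnergy A| ≤ opNorm A := by
  obtain ⟨v, hv, hv0⟩ := exists_groundVector hA
  have h := abs_quadForm_le_opNorm A v
  rw [quadForm_of_mem_groundSpace hv, abs_mul, abs_of_nonneg (sq_nonneg ‖v‖)] at h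
  exact le_of_mul_le_mul_right h (by positivity)

theorem quadForm_eq_sum_entries (A : QOp n) (v : QState n) :
    quadForm (toEuclideanLin A) v = ∑ x, ∑ y, (star (A x y * v y) * v x).re := by
  simp only [quadForm, PiLp.inner_apply, toLpLin_apply, Matrix.mulVec, dotProduct,
    RCLike.inner_apply, Complex.re_sum, Finset.mul_sum, map_sum]
  refine Finset.sum_congr rfl fun x _ => Finset.sum_congr rfl fun y _ => ?_
  rw [mul_comm]
  rfl

/-- The entrywise absolute value of a state. -/
noncomputable def absState (v : QState n) : QState n := WithLp.toLp 2 fun x => (‖v x‖ : ℂ)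

theorem norm_absState (v : QState n) : ‖absState v‖ = ‖v‖ := by
  simp [absState, EuclideanSpace.norm_eq]

/-- As in Perron–Frobenius: diagonal contributions are unchanged, and non-positive off-diagonal
entries favour aligned phases. -/
theorem quadForm_absState_le {A : QOp n} (hA : A.IsHermitian)
    (hs : ∀ x y, x ≠ y → (A x y).im = 0 ∧ (A x y).re ≤ 0) (v : QState n) :
    quadForm (toEuclideanLin A) (absState v) ≤ quadForm (toEuclideanLin A) v := by
  rw [quadForm_eq_sum_entries, quadForm_eq_sum_entries]
  refine Finset.sum_le_sum fun x _ => Finset.sum_le_sum fun y _ => ?_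
  have hreal : A x y = ((A x y).re : ℂ) := by
    by_cases hxy : x = y
    · subst hxy
      exact (hA.coe_re_apply_self x).symm
    · exact Complex.ext rfl (by simp [(hs x y hxy).1])
  rw [hreal]
  set r := (A x y).re with hr
  have h1 : (star ((r : ℂ) * absState v y) * absState v x).re = r * (‖v y‖ * ‖v x‖) := by
    simp [absState, mul_assoc]
  have h2 : (star ((r : ℂ) * v y) * v x).re = r * (star (v y) * v x).re := by
    simp [mul_assoc]
  rw [h1, h2]
  by_cases hxy : x = y
  · subst hxy
    have : (star (v x) * v x).re = ‖v x‖ * ‖v x‖ := by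
      rw [Complex.star_def, ← Complex.normSq_eq_conj_mul_self, Complex.ofReal_re,
        Complex.normSq_eq_norm_sq, sq]
    rw [this]
  · refine mul_le_mul_of_nonpos_left ?_ (hs x y hxy).2
    refine (Complex.re_le_norm _).trans_eq ?_
    simp

theorem norm_plusState : ‖plusState n‖ = 1 := by
  have h : (0 : ℝ) < 2 ^ n := by positivity
  rw [← sq_eq_sq₀ (norm_nonneg _) zero_le_one, EuclideanSpace.norm_sq_eq]
  simp [plusState, h.le, h.ne']

theorem groundOverlap_eq_norm (A : QOp n) : groundOverlap A = ‖projPlus A‖ := by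
  have h : (inner ℂ (plusState n) (projPlus A)).re = ‖projPlus A‖ ^ 2 := by
    have h1 : inner ℂ (plusState n) (projPlus A) = inner ℂ (projPlus A) (projPlus A) := by
      have := Submodule.starProjection_inner_eq_zero (K := groundSpace A) (plusState n)
        (projPlus A) (Submodule.starProjection_apply_mem _ _)
      rw [inner_sub_left, sub_eq_zero] at this
      exact this
    rw [h1]
    exact inner_self_eq_norm_sq (𝕜 := ℂ) _
  rw [groundOverlap, h, Real.sqrt_sq (norm_nonneg _)]

theorem groundOverlap_le_one (A : QOp n) : groundOverlap A ≤ 1 := by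
  rw [groundOverlap_eq_norm, ← norm_plusState (n := n)]
  exact Submodule.norm_starProjection_apply_le _ _

/-- For a ground vector `v`, `absState v` is again one, and its overlap with `|+⟩` is `2^(-n/2)`
times the `ℓ¹` norm of `v`, which dominates the `ℓ²` norm. -/
theorem inv_sqrt_le_groundOverlap {A : QOp n} (hA : A.IsHermitian)
    (hs : ∀ x y, x ≠ y → (A x y).im = 0 ∧ (A x y).re ≤ 0) {Δ : ℝ} (hΔ : HasEnergyGap A Δ) :
    (Real.sqrt ((2 : ℝ) ^ n))⁻¹ ≤ groundOverlap A := by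
  obtain ⟨v, hv, hv0⟩ := exists_groundVector hA
  have hw : absState v ∈ groundSpace A := by
    refine mem_groundSpace_of_quadForm_le hA hΔ ?_
    rw [norm_absState, ← quadForm_of_mem_groundSpace hv]
    exact quadForm_absState_le hA hs v
  have h1 : inner ℂ (absState v) (plusState n) = inner ℂ (absState v) (projPlus A) := by
    have := Submodule.sub_starProjection_mem_orthogonal (K := groundSpace A) (plusState n) _ hw
    rw [inner_sub_right, sub_eq_zero] at this
    exact this
  have h2 : inner ℂ (absState v) (plusState n) =
      (((Real.sqrt ((2 : ℝ) ^ n))⁻¹ * ∑ x, ‖v x‖ : ℝ) : ℂ) := by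
    simp [absState, plusState, PiLp.inner_apply, Finset.mul_sum]
  have h3 : ‖v‖ ≤ ∑ x, ‖v x‖ := by
    rw [EuclideanSpace.norm_eq]
    exact Real.sqrt_le_iff.mpr ⟨Finset.sum_nonneg fun _ _ => norm_nonneg _,
      Finset.sum_sq_le_sq_sum_of_nonneg fun _ _ => norm_nonneg _⟩
  have h4 := norm_inner_le_norm (𝕜 := ℂ) (absState v) (projPlus A)
  rw [← h1, h2, Complex.norm_real, norm_absState, ← groundOverlap_eq_norm] at h4
  have hv1 : 0 < ‖v‖ := norm_pos_iff.mpr hv0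
  have h5 : (Real.sqrt ((2 : ℝ) ^ n))⁻¹ * ‖v‖ ≤ ‖v‖ * groundOverlap A :=
    (mul_le_mul_of_nonneg_left h3 (by positivity)).trans ((Real.le_norm_self _).trans h4)
  rw [mul_comm] at h5
  exact le_of_mul_le_mul_left h5 hv1

end Spectral

/-! ### The gates as non-negative local kernels -/

section Gates

open Matrix

theorem replaceBits_of_mem {n : ℕ} (S : Finset (Fin n)) (x : Bits n) (y : S → Bool) :
    (fun s : S => replaceBits S x y s) = y := by
  funext s
  simp [replaceBits]

theorem replaceBits_of_notMem {n : ℕ} {S : Finset (Fin n)} (x : Bits n) (y : S → Bool) {i : Fin n}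
    (hi : i ∉ S) : replaceBits S x y i = x i := by
  simp [replaceBits, hi]

theorem ActsOn.one {n : ℕ} (S : Finset (Fin n)) : ActsOn S (1 : QOp n) := by
  refine ⟨1, fun x y => ⟨fun h => ?_, fun h => one_apply_ne fun hxy => h fun _ _ => hxy ▸ rfl⟩⟩
  by_cases hxy : x = y
  · subst hxy
    rw [one_apply_eq, one_apply_eq]
  · rw [one_apply_ne hxy, one_apply_ne]
    intro h'
    refine hxy (funext fun i => ?_)
    by_cases hi : i ∈ S
    · exact congrFun h' ⟨i, hi⟩
    · exact h i hi

theorem ActsOn.sub {n : ℕ} {S : Finset (Fin n)} {A A' : QOp n} (hA : ActsOn S A)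
    (hA' : ActsOn S A') : ActsOn S (A - A') := by
  obtain ⟨B, hB⟩ := hA
  obtain ⟨B', hB'⟩ := hA'
  refine ⟨B - B', fun x y => ⟨fun h => ?_, fun h => ?_⟩⟩
  · simp [(hB x y).1 h, (hB' x y).1 h]
  · simp [(hB x y).2 h, (hB' x y).2 h]

theorem ActsOn.smul {n : ℕ} {S : Finset (Fin n)} {A : QOp n} (hA : ActsOn S A) (c : ℂ) :
    ActsOn S (c • A) := by
  obtain ⟨B, hB⟩ := hA
  refine ⟨c • B, fun x y => ⟨fun h => ?_, fun h => ?_⟩⟩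
  · simp [(hB x y).1 h]
  · simp [(hB x y).2 h]

/-- The state with real amplitudes `f`. -/
noncomputable def realState {n : ℕ} (f : Bits n → ℝ) : QState n :=
  WithLp.toLp 2 fun x => (f x : ℂ)

theorem ActsOn.exists_localAct {n : ℕ} {S : Finset (Fin n)} {G : QOp n} (hG : ActsOn S G)
    (hre : ∀ x y, 0 ≤ (G x y).re) (him : ∀ x y, (G x y).im = 0) :
    ∃ q : (S → Bool) → (S → Bool) → ℝ, (∀ x y, 0 ≤ q x y) ∧
      ∀ f, toEuclideanLin G (realState f) = realState (localAct S q f) := by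
  obtain ⟨B, hB⟩ := hG
  have hBG : ∀ x y, G x (replaceBits S x y) = B (fun s => x s) y := by
    intro x y
    rw [(hB _ _).1 fun i hi => (replaceBits_of_notMem x y hi).symm, replaceBits_of_mem]
  refine ⟨fun x y => (B x y).re, fun x y => ?_, fun f => ?_⟩
  · have := hre (replaceBits S (fun _ => false) x)
      (replaceBits S (replaceBits S (fun _ => false) x) y)
    rwa [hBG, replaceBits_of_mem] at this
  · ext x
    simp only [toLpLin_apply, realState, mulVec, dotProduct, localAct, Complex.ofReal_sum]
    symm
    -- Row `x` of `G` is supported on the strings that agree with `x` off `S`, which `replaceBits S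
    -- x` parametrises.
    refine Finset.sum_of_injOn (replaceBits S x) ?_ (fun _ _ => Finset.mem_coe.2 (Finset.mem_univ _))
      ?_ ?_
    · intro y _ y' _ h
      rw [← replaceBits_of_mem S x y, h, replaceBits_of_mem]
    · intro y _ hy
      rw [(hB x y).2, zero_mul]
      intro h
      refine hy ⟨fun s => y s, by simp, funext fun i => ?_⟩
      by_cases hi : i ∈ S <;> simp [replaceBits, hi, h]
    · intro y _
      rw [← hBG, Complex.ofReal_mul]
      congr 1
      exact Complex.ext (by simp) (by simp [him])

/-- The operator `A` shifted and rescaled to lie between `0` and `1`. -/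
noncomputable def rescaled {n : ℕ} (J : ℝ) (A : QOp n) : QOp n :=
  (((2 * J)⁻¹ : ℝ) : ℂ) • (A - (groundEnergy A : ℂ) • 1)

theorem toEuclideanLin_rescaled {n : ℕ} (J : ℝ) (A : QOp n) (x : QState n) :
    toEuclideanLin (rescaled J A) x =
      (((2 * J)⁻¹ : ℝ) : ℂ) • (toEuclideanLin A x - (groundEnergy A : ℂ) • x) := by
  ext i
  simp [rescaled, toLpLin_apply, smul_mulVec]

theorem quadForm_rescaled {n : ℕ} (J : ℝ) (A : QOp n) (x : QState n) :
    quadForm (toEuclideanLin (rescaled J A)) x =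
      (2 * J)⁻¹ * (quadForm (toEuclideanLin A) x - groundEnergy A * ‖x‖ ^ 2) := by
  have h3 : (inner ℂ x x).re = ‖x‖ ^ 2 := inner_self_eq_norm_sq (𝕜 := ℂ) _
  rw [quadForm, toEuclideanLin_rescaled, inner_smul_left, Complex.conj_ofReal,
    Complex.re_ofReal_mul, inner_sub_left, inner_smul_left, Complex.conj_ofReal, Complex.sub_re,
    Complex.re_ofReal_mul, h3, quadForm]

theorem isHermitian_rescaled {n : ℕ} (J : ℝ) {A : QOp n} (hA : A.IsHermitian) :
    (rescaled J A).IsHermitian := by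
  unfold rescaled Matrix.IsHermitian
  rw [conjTranspose_smul, conjTranspose_sub, conjTranspose_smul, hA, conjTranspose_one]
  simp

theorem isEffect_rescaled {n : ℕ} {J : ℝ} (hJ : 0 < J) {A : QOp n} (hA : A.IsHermitian)
    (hAJ : opNorm A ≤ J) : IsEffect (toEuclideanLin (rescaled J A)) := by
  refine ⟨(isHermitian_rescaled J hA).isSymmetric_lin, fun x => ?_, fun x => ?_⟩ <;>
    rw [quadForm_rescaled]
  · exact mul_nonneg (by positivity) (sub_nonneg.mpr (groundEnergy_mul_le hA x))
  · rw [inv_mul_le_iff₀ (by positivity)]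
    have h1 := (le_abs_self _).trans (abs_quadForm_le_opNorm A x)
    have h2 := (abs_le.mp (abs_groundEnergy_le_opNorm hA)).1
    nlinarith [sq_nonneg ‖x‖]

/-- Off the diagonal this is stoquasticity; on it, the bound `K ≤ 1` evaluated at a basis vector. -/
theorem one_sub_rescaled_entries {n : ℕ} {J : ℝ} (hJ : 0 < J) {A : QOp n} (hA : A.IsHermitian)
    (hAJ : opNorm A ≤ J) (hs : ∀ x y, x ≠ y → (A x y).im = 0 ∧ (A x y).re ≤ 0) (x y : Bits n) :
    0 ≤ ((1 - rescaled J A) x y).re ∧ ((1 - rescaled J A) x y).im = 0 := by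
  by_cases hxy : x = y
  · subst hxy
    constructor
    · have h1 := (isEffect_rescaled hJ hA hAJ).le (EuclideanSpace.single x 1)
      rw [quadForm_eq_sum_entries] at h1
      simpa [PiLp.single_apply, Pi.single_apply, apply_ite, ite_mul] using h1
    · have h1 := congrArg Complex.im ((isHermitian_rescaled J hA).coe_re_apply_self x)
      have h2 : ((rescaled J A) x x).im = 0 := by simpa using h1.symm
      simp [h2]
  · have h1 : (1 - rescaled J A) x y = (((2 * J)⁻¹ : ℝ) : ℂ) * -A x y := by
      simp only [rescaled, Matrix.sub_apply, Matrix.smul_apply, one_apply_ne hxy, smul_eq_mul]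
      ring
    rw [h1, Complex.re_ofReal_mul, Complex.im_ofReal_mul, Complex.neg_re, Complex.neg_im,
      (hs x y hxy).1]
    exact ⟨mul_nonneg (by positivity) (by linarith [(hs x y hxy).2]), by simp⟩

theorem exists_localAct_of_isLocalOp {n k : ℕ} {J : ℝ} (hJ : 0 < J) {A : QOp n}
    (hA : A.IsHermitian) (hAJ : opNorm A ≤ J)
    (hs : ∀ x y, x ≠ y → (A x y).im = 0 ∧ (A x y).re ≤ 0) (hk : IsLocalOp k A) :
    ∃ (S : Finset (Fin n)) (q : (S → Bool) → (S → Bool) → ℝ), S.card ≤ k ∧ (∀ x y, 0 ≤ q x y) ∧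
      ∀ f, realState f - toEuclideanLin (rescaled J A) (realState f) =
        realState (localAct S q f) := by
  obtain ⟨S, hS, hAS⟩ := hk
  have hG : ActsOn S (1 - rescaled J A) :=
    (ActsOn.one S).sub ((hAS.sub ((ActsOn.one S).smul _)).smul _)
  obtain ⟨q, hq, h⟩ := hG.exists_localAct
    (fun x y => (one_sub_rescaled_entries hJ hA hAJ hs x y).1)
    (fun x y => (one_sub_rescaled_entries hJ hA hAJ hs x y).2)
  refine ⟨S, q, hS, hq, fun f => ?_⟩
  rw [← h f, map_sub, LinearMap.sub_apply]
  congr 1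
  ext i
  simp

/-! ### Sweeps for a frustration-free Hamiltonian -/

section Ham

variable {n k L : ℕ} {h : Fin L → QOp n} {J Δ : ℝ}

theorem isHermitian_totalHam (hh : IsSFF k h) : (totalHam h).IsHermitian := by
  unfold totalHam Matrix.IsHermitian
  rw [conjTranspose_sum]
  exact Finset.sum_congr rfl fun a _ => (hh.1 a).1

theorem stoquastic_totalHam (hh : IsSFF k h) (x y : Bits n) (hxy : x ≠ y) :
    (totalHam h x y).im = 0 ∧ (totalHam h x y).re ≤ 0 := by
  rw [totalHam, Matrix.sum_apply, Complex.im_sum, Complex.re_sum]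
  exact ⟨Finset.sum_eq_zero fun a _ => (hh.2.1 a x y hxy).1,
    Finset.sum_nonpos fun a _ => (hh.2.1 a x y hxy).2⟩

theorem quadForm_totalHam (h : Fin L → QOp n) (x : QState n) :
    quadForm (toEuclideanLin (totalHam h)) x = ∑ a, quadForm (toEuclideanLin (h a)) x := by
  simp [quadForm, totalHam, LinearMap.sum_apply]

/-- Evaluate the energy on a common ground vector, which frustration-freeness provides. The gap of
`H` thereby becomes a bound on the summed forms of the rescaled terms. -/
theorem groundEnergy_totalHam (hh : IsSFF k h) :
    groundEnergy (totalHam h) = ∑ a, groundEnergy (h a) := by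
  obtain ⟨v, hv, hv0⟩ := exists_groundVector (isHermitian_totalHam hh)
  have h1 := quadForm_of_mem_groundSpace hv
  rw [quadForm_totalHam, Finset.sum_congr rfl fun a _ =>
    quadForm_of_mem_groundSpace (hh.2.2 a hv), ← Finset.sum_mul] at h1
  exact (mul_right_cancel₀ (by positivity) h1).symm

theorem rescaled_of_mem_groundSpace (hh : IsSFF k h) {x : QState n}
    (hx : x ∈ groundSpace (totalHam h)) (a : Fin L) :
    toEuclideanLin (rescaled J (h a)) x = 0 := by
  rw [toEuclideanLin_rescaled, mem_groundSpace.mp (hh.2.2 a hx), sub_self, smul_zero]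

theorem rescaled_mem_orthogonal (hh : IsSFF k h) (a : Fin L) (x : QState n) :
    toEuclideanLin (rescaled J (h a)) x ∈ (groundSpace (totalHam h))ᗮ := by
  intro v hv
  rw [← (isHermitian_rescaled J (hh.1 a).1).isSymmetric_lin, rescaled_of_mem_groundSpace hh hv,
    inner_zero_left]

theorem gap_mul_le_sum_rescaled (hJ : 0 < J) (hh : IsSFF k h) (hΔ : HasEnergyGap (totalHam h) Δ)
    (x : QState n) (hx : x ∈ (groundSpace (totalHam h))ᗮ) :
    Δ / (2 * J) * ‖x‖ ^ 2 ≤ ∑ a, quadForm (toEuclideanLin (rescaled J (h a))) x := by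
  have h1 := hΔ.mul_le (isHermitian_totalHam hh) hx
  simp_rw [quadForm_rescaled]
  rw [← Finset.mul_sum, Finset.sum_sub_distrib, ← quadForm_totalHam, ← Finset.sum_mul,
    ← groundEnergy_totalHam hh, div_eq_inv_mul, mul_assoc]
  exact mul_le_mul_of_nonneg_left (by linarith) (by positivity)

/-- The spectrum of `H` lies in `[-LJ, LJ]`, so a gap above `2LJ` leaves no excited state. In the
remaining case `LJ / Δ` is bounded below, which lets rounding errors be absorbed. -/
theorem groundSpace_orthogonal_eq_bot (hh : IsSFF k h) (hJ : ∀ a, opNorm (h a) ≤ J)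
    (hΔ : HasEnergyGap (totalHam h) Δ) (hlt : 2 * L * J < Δ) {x : QState n}
    (hx : x ∈ (groundSpace (totalHam h))ᗮ) : x = 0 := by
  have h1 := hΔ.mul_le (isHermitian_totalHam hh) hx
  have h2 : quadForm (toEuclideanLin (totalHam h)) x ≤ ∑ _a : Fin L, J * ‖x‖ ^ 2 := by
    rw [quadForm_totalHam]
    exact Finset.sum_le_sum fun a _ => ((le_abs_self _).trans (abs_quadForm_le_opNorm _ _)).trans
      (mul_le_mul_of_nonneg_right (hJ a) (sq_nonneg _))
  have h3 : ∑ _a : Fin L, -J ≤ groundEnergy (totalHam h) := by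
    rw [groundEnergy_totalHam hh]
    exact Finset.sum_le_sum fun a _ =>
      (neg_le_neg (hJ a)).trans (abs_le.mp (abs_groundEnergy_le_opNorm (hh.1 a).1)).1
  simp only [Finset.sum_const, Finset.card_univ, Fintype.card_fin, nsmul_eq_mul] at h2 h3
  have h4 : ‖x‖ ^ 2 ≤ 0 := by
    by_contra! hcon
    have h5 := mul_lt_mul_of_pos_right hlt hcon
    have h6 := mul_le_mul_of_nonneg_right h3 hcon.le
    linarith
  simpa using le_antisymm h4 (sq_nonneg _)

/-- The rescaled terms, as operators. -/
noncomputable def terms (J : ℝ) (h : Fin L → QOp n) (a : Fin L) : Module.End ℂ (QState n) :=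
  toEuclideanLin (rescaled J (h a))

theorem exists_netFun_gateProd (hJ : 0 < J) (hh : IsSFF k h) (hhJ : ∀ a, opNorm (h a) ≤ J) {N : ℕ}
    (l : List (Fin L)) {f : Bits n → ℝ}
    (hf : f ∈ closure (netFun n (2 ^ (2 * k)) (2 ^ (2 * k + 1)) N)) :
    ∃ f' ∈ closure (netFun n (2 ^ (2 * k)) (2 ^ (2 * k + 1)) (N + l.length * (2 * 2 ^ (2 * k)))),
      gateProd (terms J h) l (realState f) = realState f' := by
  induction l with
  | nil => exact ⟨f, by simpa using hf, gateProd_nil _ _⟩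
  | cons a l ih =>
    obtain ⟨f', hf', hl⟩ := ih
    obtain ⟨S, q, hS, hq, hact⟩ := exists_localAct_of_isLocalOp hJ (hh.1 a).1 (hhJ a) (hh.2.1 a)
      (hh.1 a).2
    refine ⟨localAct S q f', ?_, ?_⟩
    · have := closure_netFun_localAct hS hq hf'
      rwa [add_assoc, ← Nat.succ_mul] at this
    · rw [gateProd_cons, hl, ← hact]
      rfl

theorem exists_netFun_gateProd_pow (hJ : 0 < J) (hh : IsSFF k h) (hhJ : ∀ a, opNorm (h a) ≤ J)
    {f : Bits n → ℝ} (hf : f ∈ closure (netFun n (2 ^ (2 * k)) (2 ^ (2 * k + 1)) 0)) (T : ℕ) :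
    ∃ f' ∈ closure (netFun n (2 ^ (2 * k)) (2 ^ (2 * k + 1)) (T * (L * (2 * 2 ^ (2 * k))))),
      (gateProd (terms J h) (List.finRange L) ^ T) (realState f) = realState f' := by
  induction T with
  | zero => exact ⟨f, by simpa using hf, by simp⟩
  | succ T ih =>
    obtain ⟨f', hf', hl⟩ := ih
    obtain ⟨f'', hf'', hl'⟩ := exists_netFun_gateProd hJ hh hhJ (List.finRange L) hf'
    refine ⟨f'', ?_, ?_⟩
    · rwa [List.length_finRange, ← Nat.succ_mul] at hf''
    · rw [pow_succ', Module.End.mul_apply, hl, hl']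

theorem plusState_eq_realState : plusState n = realState fun _ => (Real.sqrt ((2 : ℝ) ^ n))⁻¹ := rfl

theorem gateProd_pow_plusState (hJ : 0 < J) (hL : 0 < L) (hh : IsSFF k h)
    (hhJ : ∀ a, opNorm (h a) ≤ J) (hΔ : HasEnergyGap (totalHam h) Δ) (T : ℕ) :
    ‖(gateProd (terms J h) (List.finRange L) ^ T) (plusState n) - projPlus (totalHam h)‖ ^ 2 ≤
      Real.exp (-(Δ / (2 * J) / (L : ℝ) ^ 2) * T) := by
  set P := projPlus (totalHam h) with hP
  have hPm : P ∈ groundSpace (totalHam h) := Submodule.starProjection_apply_mem _ _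
  have hr : plusState n - P ∈ (groundSpace (totalHam h))ᗮ :=
    Submodule.sub_starProjection_mem_orthogonal _
  have h1 : (gateProd (terms J h) (List.finRange L) ^ T) P = P := by
    induction T with
    | zero => simp
    | succ T ih =>
      rw [pow_succ, Module.End.mul_apply,
        gateProd_of_ker (K := terms J h) (fun a => rescaled_of_mem_groundSpace hh hPm a), ih]
  have h2 := (norm_gateProd_pow_sq_le hL (K := terms J h)
    (fun a => isEffect_rescaled hJ (hh.1 a).1 (hhJ a))
    (fun a x _ => rescaled_mem_orthogonal hh a x) (gap_mul_le_sum_rescaled hJ hh hΔ) T hr).2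
  rw [map_sub, h1] at h2
  refine h2.trans (mul_le_of_le_one_right (Real.exp_pos _).le ?_)
  have h3 : plusState n - P = (groundSpace (totalHam h))ᗮ.starProjection (plusState n) := by
    rw [Submodule.starProjection_orthogonal_val]
    rfl
  rw [h3]
  refine pow_le_one₀ (norm_nonneg _) ?_
  rw [← norm_plusState (n := n)]
  exact Submodule.norm_starProjection_apply_le _ _

end Ham

/-! ### From state distance to total variation -/

section Distance

variable {n : ℕ}

/-- Factor the difference of squares and apply Cauchy–Schwarz. -/
theorem tvDist_stateDist_le {φ ψ : QState n} (hφ : ‖φ‖ = 1) (hψ : ‖ψ‖ = 1) :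
    tvDist (stateDist φ) (stateDist ψ) ≤ ‖φ - ψ‖ := by
  have h1 : ∀ x, |stateDist φ x - stateDist ψ x| ≤
      ‖(φ - ψ) x‖ * ‖φ x‖ + ‖(φ - ψ) x‖ * ‖ψ x‖ := by
    intro x
    have : stateDist φ x - stateDist ψ x = (‖φ x‖ - ‖ψ x‖) * (‖φ x‖ + ‖ψ x‖) := by
      simp only [stateDist]
      ring
    rw [this, abs_mul, abs_of_nonneg (by positivity : 0 ≤ ‖φ x‖ + ‖ψ x‖), ← mul_add]
    exact mul_le_mul_of_nonneg_right (abs_norm_sub_norm_le _ _) (by positivity)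
  have hcs : ∀ u v : QState n, ∑ x, ‖u x‖ * ‖v x‖ ≤ ‖u‖ * ‖v‖ := by
    intro u v
    rw [EuclideanSpace.norm_eq, EuclideanSpace.norm_eq]
    exact Real.sum_mul_le_sqrt_mul_sqrt _ _ _
  have h2 := Finset.sum_le_sum fun x (_ : x ∈ Finset.univ) => h1 x
  rw [Finset.sum_add_distrib] at h2
  have h3 := hcs (φ - ψ) φ
  have h4 := hcs (φ - ψ) ψ
  rw [hφ, mul_one] at h3
  rw [hψ, mul_one] at h4
  unfold tvDist
  linarith

theorem norm_normalize_sub_le {φ ψ : QState n} (hφ : φ ≠ 0) (hψ : ‖ψ‖ = 1) :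
    ‖((‖φ‖⁻¹ : ℝ) : ℂ) • φ - ψ‖ ≤ 2 * ‖φ - ψ‖ := by
  have hφ' : 0 < ‖φ‖ := norm_pos_iff.mpr hφ
  have h1 : ‖((‖φ‖⁻¹ : ℝ) : ℂ) • φ - φ‖ ≤ ‖φ - ψ‖ := by
    have : ((‖φ‖⁻¹ : ℝ) : ℂ) • φ - φ = ((‖φ‖⁻¹ - 1 : ℝ) : ℂ) • φ := by
      push_cast
      rw [sub_smul, one_smul]
    rw [this, norm_smul, Complex.norm_real, Real.norm_eq_abs]
    calc |‖φ‖⁻¹ - 1| * ‖φ‖ = |(‖φ‖⁻¹ - 1) * ‖φ‖| := by rw [abs_mul, abs_norm]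
      _ = |‖φ‖ - ‖ψ‖| := by
        rw [sub_mul, inv_mul_cancel₀ hφ'.ne', hψ, one_mul, abs_sub_comm]
      _ ≤ _ := abs_norm_sub_norm_le _ _
  calc _ = ‖(((‖φ‖⁻¹ : ℝ) : ℂ) • φ - φ) + (φ - ψ)‖ := by rw [sub_add_sub_cancel]
    _ ≤ _ := norm_add_le _ _
    _ ≤ _ := by linarith

/-- A state whose amplitudes are a limit of network functions, and which is close in direction to
`ψ`, yields a deep Boltzmann machine for `ψ`. -/
theorem exists_dbm_of_realState {k N : ℕ} {f : Bits n → ℝ}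
    (hf : f ∈ closure (netFun n (2 ^ (2 * k)) (2 ^ (2 * k + 1)) N)) {ψ : QState n} (hψ : ‖ψ‖ = 1)
    {c ε : ℝ} (hε : ε ≤ 1) (hclose : 2 * ‖(c : ℂ) • realState f - ψ‖ < ε) :
    ∃ (m d : ℕ) (B : DBM n m d), B.Represents ψ ε ∧ m + d ≤ 2 * N ∧
      B.DegreeLE (2 ^ (2 * k + 1)) := by
  set φ := (c : ℂ) • realState f with hφ
  have hφ0 : φ ≠ 0 := by
    intro h0
    rw [h0, zero_sub, norm_neg, hψ] at hclose
    linarith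
  have hnorm : ‖((‖φ‖⁻¹ : ℝ) : ℂ) • φ‖ = 1 := by
    rw [norm_smul, Complex.norm_real, norm_inv, norm_norm, inv_mul_cancel₀ (norm_ne_zero_iff.mpr hφ0)]
  have hφx : ∀ x, ‖φ x‖ ^ 2 = c ^ 2 * (f * f) x := by
    intro x
    simp [hφ, realState, sq]
    rw [mul_mul_mul_comm, abs_mul_abs_self, abs_mul_abs_self]
  have hsum : ‖φ‖ ^ 2 = c ^ 2 * ∑ x, (f * f) x := by
    rw [EuclideanSpace.norm_sq_eq, Finset.mul_sum]
    exact Finset.sum_congr rfl fun x _ => hφx x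
  have hpos : c ^ 2 * ∑ x, (f * f) x ≠ 0 := by
    rw [← hsum]
    exact pow_ne_zero _ (norm_ne_zero_iff.mpr hφ0)
  have hdist : (fun x => (f * f) x / ∑ y, (f * f) y) =
      stateDist (((‖φ‖⁻¹ : ℝ) : ℂ) • φ) := by
    funext x
    have : stateDist (((‖φ‖⁻¹ : ℝ) : ℂ) • φ) x = ‖φ x‖ ^ 2 / ‖φ‖ ^ 2 := by
      rw [stateDist, PiLp.smul_apply, norm_smul, Complex.norm_real, norm_inv, norm_norm]
      ring
    rw [this, hφx, hsum, mul_div_mul_left _ _ (left_ne_zero_of_mul hpos)]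
  have htv : tvDist (fun x => (f * f) x / ∑ y, (f * f) y) (stateDist ψ) < ε := by
    rw [hdist]
    exact ((tvDist_stateDist_le hnorm hψ).trans (norm_normalize_sub_le hφ0 hψ)).trans_lt hclose
  -- Squaring doubles the visible degree to `2^(2k+1)`, which the hidden nodes were already allowed.
  obtain ⟨m, d, B, h1, h2, h3⟩ := exists_dbm_of_mem_closure_netFun (closure_netFun_sq hf)
    (right_ne_zero_of_mul hpos) htv
  exact ⟨m, d, B, h3, h1, h2⟩

end Distance

end Gates

/-! ### Counting sweeps and hidden nodes -/

section Main

variable {n k L : ℕ} {h : Fin L → QOp n} {J Δ : ℝ}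

theorem groundOverlap_pos (hh : IsSFF k h) (hΔ : HasEnergyGap (totalHam h) Δ) :
    0 < groundOverlap (totalHam h) :=
  lt_of_lt_of_le (by positivity)
    (inv_sqrt_le_groundOverlap (isHermitian_totalHam hh) (stoquastic_totalHam hh) hΔ)

theorem log_inv_groundOverlap_le (hh : IsSFF k h) (hΔ : HasEnergyGap (totalHam h) Δ) :
    Real.log (groundOverlap (totalHam h))⁻¹ ≤ (n : ℝ) / 2 * Real.log 2 := by
  have h1 := inv_sqrt_le_groundOverlap (isHermitian_totalHam hh) (stoquastic_totalHam hh) hΔ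
  have h2 := Real.log_le_log (by positivity) h1
  rw [Real.log_inv, Real.log_sqrt (by positivity), Real.log_pow] at h2
  rw [Real.log_inv]
  linarith

theorem norm_groundState {A : QOp n} (hA : 0 < groundOverlap A) : ‖groundState A‖ = 1 := by
  rw [groundState, norm_smul, Complex.norm_real, norm_inv, Real.norm_of_nonneg hA.le,
    ← groundOverlap_eq_norm, inv_mul_cancel₀ hA.ne']

theorem norm_plusState_sub_groundState_sq {A : QOp n} (hA : 0 < groundOverlap A) :
    ‖plusState n - groundState A‖ ^ 2 = 2 - 2 * groundOverlap A := by
  have h1 : (inner ℂ (plusState n) (projPlus A)).re = groundOverlap A ^ 2 := by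
    rw [groundOverlap, Real.sq_sqrt]
    exact (Real.sqrt_pos.mp hA).le
  have h2 : RCLike.re (inner ℂ (plusState n) (groundState A)) = groundOverlap A := by
    rw [groundState, inner_smul_right]
    refine (Complex.re_ofReal_mul _ _).trans ?_
    rw [h1, sq, inv_mul_cancel_left₀ hA.ne']
  rw [norm_sub_sq (𝕜 := ℂ), h2, norm_plusState, norm_groundState hA]
  ring

/-- If `|+⟩` is close to the ground state, no hidden nodes are needed. -/
theorem exists_dbm_of_plusState_close (k : ℕ) {A : QOp n} (hA : 0 < groundOverlap A) {ε : ℝ}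
    (hε : ε ≤ 1) (hclose : 2 * ‖plusState n - groundState A‖ < ε) :
    ∃ (m d : ℕ) (B : DBM n m d), B.Represents (groundState A) ε ∧ m + d ≤ 0 ∧
      B.DegreeLE (2 ^ (2 * k + 1)) := by
  have hf := subset_closure (const_mem_netFun n (2 ^ (2 * k)) (2 ^ (2 * k + 1)) 0
    (c := (Real.sqrt ((2 : ℝ) ^ n))⁻¹) (by positivity))
  refine exists_dbm_of_realState (N := 0) hf (norm_groundState hA) (c := 1) hε ?_
  rwa [Complex.ofReal_one, one_smul, ← plusState_eq_realState]

/-- Dividing by `η` amplifies the error, hence the target `ηε`. The extra `2` next to the logarithm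
gains `exp (-2)`, which beats the factor `2` lost in normalising the state. -/
theorem exists_dbm_of_sweeps (hJ : 0 < J) (hL : 0 < L) (hh : IsSFF k h)
    (hhJ : ∀ a, opNorm (h a) ≤ J) (hΔ : HasEnergyGap (totalHam h) Δ) {ε : ℝ} (hε0 : 0 < ε)
    (hε : ε ≤ 1) {T : ℕ}
    (hT : 4 * (J * (L : ℝ) ^ 2 / Δ) *
      (Real.log ((groundOverlap (totalHam h))⁻¹ * ε⁻¹) + 2) ≤ T) :
    ∃ (m d : ℕ) (B : DBM n m d), B.Represents (groundState (totalHam h)) ε ∧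
      m + d ≤ 2 * (T * (L * (2 * 2 ^ (2 * k)))) ∧ B.DegreeLE (2 ^ (2 * k + 1)) := by
  have hη := groundOverlap_pos hh hΔ
  have hf := subset_closure (const_mem_netFun n (2 ^ (2 * k)) (2 ^ (2 * k + 1)) 0
    (c := (Real.sqrt ((2 : ℝ) ^ n))⁻¹) (by positivity))
  obtain ⟨f, hf', hfT⟩ := exists_netFun_gateProd_pow hJ hh hhJ hf T
  have hnorm := gateProd_pow_plusState hJ hL hh hhJ hΔ T
  rw [plusState_eq_realState, hfT] at hnorm
  set η := groundOverlap (totalHam h) with hηdef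
  set ℓ := Real.log (η⁻¹ * ε⁻¹) with hℓ
  refine exists_dbm_of_realState hf' (norm_groundState hη) (c := η⁻¹) hε ?_
  have hΔ0 := hΔ.1
  have hL' : (0 : ℝ) < L := Nat.cast_pos.mpr hL
  have h1 : -(Δ / (2 * J) / (L : ℝ) ^ 2) * T ≤ 2 * -(ℓ + 2) := by
    have h2 := mul_le_mul_of_nonneg_left hT (by positivity : 0 ≤ Δ / (2 * J) / (L : ℝ) ^ 2)
    have h3 : Δ / (2 * J) / (L : ℝ) ^ 2 * (4 * (J * (L : ℝ) ^ 2 / Δ) * (ℓ + 2)) =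
        2 * (ℓ + 2) := by
      field_simp
      ring
    linarith
  have h2 : ‖realState f - projPlus (totalHam h)‖ ≤ Real.exp (-(ℓ + 2)) := by
    refine (sq_le_sq₀ (norm_nonneg _) (Real.exp_pos _).le).mp (hnorm.trans ?_)
    rw [← Real.exp_nat_mul]
    exact Real.exp_le_exp.mpr (by exact_mod_cast h1)
  have h3 : Real.exp (-(ℓ + 2)) = η * ε * Real.exp (-2) := by
    rw [neg_add, Real.exp_add, Real.exp_neg ℓ, hℓ, Real.exp_log (by positivity)]
    field_simp
  have h4 : 2 * Real.exp (-2) < 1 := by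
    have h5 : (3 : ℝ) ≤ Real.exp 2 := by
      have := Real.add_one_le_exp (2 : ℝ)
      linarith
    rw [Real.exp_neg, ← div_eq_mul_inv, div_lt_one (Real.exp_pos _)]
    linarith
  rw [groundState, ← smul_sub, norm_smul, Complex.norm_real, norm_inv, Real.norm_of_nonneg hη.le]
  calc 2 * (η⁻¹ * ‖realState f - projPlus (totalHam h)‖)
      ≤ 2 * (η⁻¹ * (η * ε * Real.exp (-2))) := by
        rw [← h3]
        gcongr
    _ = ε * (2 * Real.exp (-2)) := by
        field_simp
    _ < ε * 1 := mul_lt_mul_of_pos_left h4 hε0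
    _ = ε := mul_one ε

end Main

theorem mainTheorem8 :
    ∃ C : ℝ, 0 < C ∧
      ∀ (n k L : ℕ) (h : Fin L → QOp n) (J Δ : ℝ),
        IsSFF k h →
        (∀ a, opNorm (h a) ≤ J) →
        HasEnergyGap (totalHam h) Δ →
        (0 < groundOverlap (totalHam h) ∧
          Real.log (groundOverlap (totalHam h))⁻¹ ≤ (n : ℝ) / 2 * Real.log 2) ∧
        ∀ ε : ℝ, 0 < ε → ε ≤ 1 →
          ∃ (m d : ℕ) (B : DBM n m d),
            B.Represents (groundState (totalHam h)) ε ∧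
            ((m + d : ℕ) : ℝ) ≤
              C * 2 ^ (2 * k) * (L : ℝ) ^ 3 * J * Δ⁻¹ *
                Real.log ((groundOverlap (totalHam h))⁻¹ * ε⁻¹) ∧
            B.DegreeLE (2 ^ (2 * k + 1)) := by
  -- `5000 = 4 * 1250`: the number of sweeps is at most `1250 R ℓ`, and each sweep costs `4 L
  -- 2^(2k)` nodes after squaring.
  refine ⟨5000, by norm_num, fun n k L h J Δ hh hhJ hΔ => ?_⟩
  have hη := groundOverlap_pos hh hΔ
  refine ⟨⟨hη, log_inv_groundOverlap_le hh hΔ⟩, fun ε hε0 hε => ?_⟩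
  have hη1 := groundOverlap_le_one (totalHam h)
  have hΔ0 := hΔ.1
  have hLJ : 0 ≤ (L : ℝ) ^ 3 * J := by
    rcases Nat.eq_zero_or_pos L with rfl | hL
    · simp
    · exact mul_nonneg (by positivity) ((norm_nonneg _).trans (hhJ ⟨0, hL⟩))
  have hℓ0 : 0 ≤ Real.log ((groundOverlap (totalHam h))⁻¹ * ε⁻¹) :=
    Real.log_nonneg (one_le_mul_of_one_le_of_one_le ((one_le_inv₀ hη).mpr hη1)
      ((one_le_inv₀ hε0).mpr hε))
  have hC0 : 0 ≤ 5000 * 2 ^ (2 * k) * (L : ℝ) ^ 3 * J * Δ⁻¹ *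
      Real.log ((groundOverlap (totalHam h))⁻¹ * ε⁻¹) := by
    rw [mul_assoc (5000 * 2 ^ (2 * k)) ((L : ℝ) ^ 3) J]
    positivity
  -- When the logarithm is tiny or zero, the bound may leave no room for any hidden node; then `|+⟩`
  -- itself must serve.
  have htrivial : 2 * ‖plusState n - groundState (totalHam h)‖ < ε →
      ∃ (m d : ℕ) (B : DBM n m d), B.Represents (groundState (totalHam h)) ε ∧
        ((m + d : ℕ) : ℝ) ≤ 5000 * 2 ^ (2 * k) * (L : ℝ) ^ 3 * J * Δ⁻¹ *
          Real.log ((groundOverlap (totalHam h))⁻¹ * ε⁻¹) ∧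
        B.DegreeLE (2 ^ (2 * k + 1)) := by
    intro hclose
    obtain ⟨m, d, B, h1, h2, h3⟩ := exists_dbm_of_plusState_close k hη hε hclose
    refine ⟨m, d, B, h1, ?_, h3⟩
    rw [Nat.le_zero.mp h2, Nat.cast_zero]
    exact hC0
  have hsq := norm_plusState_sub_groundState_sq hη
  rcases lt_or_ge (2 * L * J) Δ with hlt | hge
  · apply htrivial
    have h1 := groundSpace_orthogonal_eq_bot hh hhJ hΔ hlt
      (Submodule.sub_starProjection_mem_orthogonal (K := groundSpace (totalHam h)) (plusState n))
    have h2 : groundOverlap (totalHam h) = 1 := by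
      rw [groundOverlap_eq_norm, ← norm_plusState (n := n), sub_eq_zero.mp h1]
      rfl
    rw [h2, mul_one, sub_self] at hsq
    rw [pow_eq_zero_iff two_ne_zero |>.mp hsq]
    simpa using hε0
  · have hL : 0 < L := by
      rcases Nat.eq_zero_or_pos L with rfl | hL
      · simp at hge
        linarith
      · exact hL
    have hL' : (1 : ℝ) ≤ L := Nat.one_le_cast.mpr hL
    have hJ : 0 < J := by
      by_contra! hJ
      nlinarith
    set η := groundOverlap (totalHam h) with hηdef
    set ℓ := Real.log (η⁻¹ * ε⁻¹) with hℓ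
    rcases lt_or_ge ℓ (1 / 100) with hsmall | hbig
    · apply htrivial
      -- Since `ηε = exp (-ℓ)` and both factors are at most `1`, each is at least `99/100`; then
      -- `‖|+⟩ - ψ₀‖² = 2 - 2η ≤ 1/50`.
      have h1 : 99 / 100 ≤ η * ε := by
        have h2 : η * ε = Real.exp (-ℓ) := by
          rw [Real.exp_neg, hℓ, Real.exp_log (by positivity)]
          field_simp
        have h3 := Real.add_one_le_exp (-ℓ)
        rw [h2]
        linarith
      have h2 : 99 / 100 ≤ η := by nlinarith
      have h3 : 99 / 100 ≤ ε := by nlinarith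
      have h4 : ‖plusState n - groundState (totalHam h)‖ ≤ 1 / 5 := by
        refine (sq_le_sq₀ (norm_nonneg _) (by norm_num)).mp ?_
        rw [hsq]
        linarith
      linarith
    · set R := J * (L : ℝ) ^ 2 / Δ with hR
      obtain ⟨m, d, B, h1, h2, h3⟩ := exists_dbm_of_sweeps hJ hL hh hhJ hΔ hε0 hε
        (Nat.le_ceil (4 * R * (ℓ + 2)))
      refine ⟨m, d, B, h1, ?_, h3⟩
      have hR1 : 1 ≤ 2 * R := by
        rw [hR, ← mul_div_assoc, one_le_div hΔ0]
        nlinarith [mul_pos hJ (zero_lt_one.trans_le hL')]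
      have hT := (Nat.ceil_lt_add_one (by positivity : 0 ≤ 4 * R * (ℓ + 2))).le
      -- By `1 ≤ 2R` the ceiling is at most `4Rℓ + 10R`, and `1/100 ≤ ℓ` turns `10R` into at most
      -- `1000Rℓ`.
      have hT' : (⌈4 * R * (ℓ + 2)⌉₊ : ℝ) ≤ 1250 * R * ℓ := by
        have := mul_le_mul_of_nonneg_left hbig (by linarith : 0 ≤ R)
        nlinarith
      calc ((m + d : ℕ) : ℝ)
          ≤ ((2 * (⌈4 * R * (ℓ + 2)⌉₊ * (L * (2 * 2 ^ (2 * k)))) : ℕ) : ℝ) := Nat.cast_le.mpr h2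
        _ = (⌈4 * R * (ℓ + 2)⌉₊ : ℝ) * (4 * L * 2 ^ (2 * k)) := by
          push_cast
          ring
        _ ≤ 1250 * R * ℓ * (4 * L * 2 ^ (2 * k)) :=
          mul_le_mul_of_nonneg_right hT' (by positivity)
        _ = _ := by
          rw [hR]
          field_simp
          ring
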